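/- Let $N\ge 2$ and $0<\alpha<1$, write $x=(x',x_N)\in\mathbb R^{N-1}\times\mathbb R$, put $\psi(t)=\frac{|t|^{1+\alpha}}{1+\alpha}$, and let $\omega_{N-1}$ be the volume of the unit ball of $\mathbb R^{N-1}$. Consider open connected sets $\Omega\subset\mathbb R^N$ of class $C^{1,\alpha}$ with $0\in\partial\Omega$ such that, for some $\eta>0$, $$\Omega\cap\{x_N<\eta\}=\{x:\ \psi(|x'|)<x_N<\eta\}.\qquad(\ast)$$ Here $\int_\Omega|Du|$ is the total variation of $u$ in $\Omega$, and $\int_{\partial\Omega}|u|$ is the integral of the absolute value of the trace of $u$ with respect to the $(N-1)$-dimensional Hausdorff measure (normalized to agree with Lebesgue measure on $\mathbb R^{N-1}$). The trace of $u$ at $x\in\partial\Omega$ is the number $c$ for which the mean value of $|u-c|$ over $B(x,\rho)\cap\Omega$ tends to $0$ as $\rho\to0^+$. (A) For all $N\ge2$ and $0<\alpha<1$ there exist bounded domains of this kind. (B) Let $\Omega$ be any domain of this kind, let $r_n\to0^+$, and put $E_n=\{x:\ \psi(|x'|)<x_N<\psi(r_n)\}$ and $u_n=\chi_{E_n}$.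 Then for all large $n$: $E_n\subset\Omega$; $u_n\in BV(\Omega)$; the trace of $u_n$ exists and equals $1$ on $\partial\Omega\cap\{x_N<\psi(r_n)\}$ and $0$ on the rest of $\partial\Omega$, up to a set of $(N-1)$-dimensional Hausdorff measure zero; and $$\int_{\partial\Omega}|u_n|=\int_{|x'|<r_n}\sqrt{1+|x'|^{2\alpha}}\,dx',\qquad \int_\Omega|Du_n|=\omega_{N-1}r_n^{N-1},\qquad \int_\Omega|u_n|=\frac{\omega_{N-1}}{N+\alpha}\,r_n^{N+\alpha}.$$ Moreover, as $n\to\infty$, $$\int_{\partial\Omega}|u_n|=\omega_{N-1}r_n^{N-1}+\frac{(N-1)\,\omega_{N-1}}{2(N-1+2\alpha)}\,r_n^{N-1+2\alpha}+O\big(r_n^{N-1+4\alpha}\big),$$ and for every $C\in\mathbb R$ one has $\int_{\partial\Omega}|u_n|>\int_\Omega|Du_n|+C\int_\Omega|u_n|$ for all large $n$. (C) Consequently, for no domain $\Omega$ of this kind is there a constant $C$ such that $$\int_{\partial\Omega}|u|\le\int_\Omega|Du|+C\int_\Omega|u|\qquad\text{for all }u\in BV(\Omega).$$ In particular, for every $N\ge2$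 and $0<\alpha<1$ there is a bounded $C^{1,\alpha}$ domain on which this inequality fails for every $C$. -/

import Mathlib

open MeasureTheory Filter Topology Set Metric Asymptotics
open scoped ENNReal

noncomputable section

/-- Euclidean space `ℝ^d`. -/
abbrev Euc (d : ℕ) : Type := EuclideanSpace ℝ (Fin d)

/-- The first `d` coordinates `x'` of a point `x = (x', x_N)` of `ℝ^N`, where `N = d + 1`. -/
def horiz {d : ℕ} (x : Euc (d + 1)) : Euc d := WithLp.toLp 2 (fun i : Fin d => x i.castSucc)

/-- The last coordinate `x_N` of a point `x = (x', x_N)` of `ℝ^N`, where `N = d + 1`. -/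
def vert {d : ℕ} (x : Euc (d + 1)) : ℝ := x (Fin.last d)

/-- The volume of the unit ball of `ℝ^d`. -/
def unitBallVolume (d : ℕ) : ℝ := volume.real (ball (0 : Euc d) 1)

/-- `f` is of class `C^{1,α}` on the open set `W`: it is `C^1` there and its derivative is
`α`-Hölder continuous on `W`. -/
def IsC1HolderOn {d : ℕ} (α : ℝ) (f : Euc d → ℝ) (W : Set (Euc d)) : Prop :=
  ContDiffOn ℝ 1 f W ∧
    ∃ K : ℝ, ∀ x ∈ W, ∀ y ∈ W, ‖fderiv ℝ f x - fderiv ℝ f y‖ ≤ K * ‖x - y‖ ^ α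

/-- `Ω ⊆ ℝ^N`, `N = d + 1`, is a `C^{1,α}` domain: it is open and connected, and near each boundary
point it is, in suitable orthogonal coordinates, the region strictly above the graph of a `C^{1,α}`
function of `d` variables. -/
structure IsC1HolderDomain {d : ℕ} (α : ℝ) (Ω : Set (Euc (d + 1))) : Prop where
  isOpen : IsOpen Ω
  isConnected : IsConnected Ω
  isLocalGraph : ∀ p ∈ frontier Ω, ∃ ρ : ℝ, 0 < ρ ∧
    ∃ (T : Euc (d + 1) ≃ₗᵢ[ℝ] Euc (d + 1)) (f : Euc d → ℝ),
      IsC1HolderOn α f (ball (horiz (T p)) ρ) ∧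
      ∀ x ∈ ball p ρ, x ∈ Ω ↔ f (horiz (T x)) < vert (T x)

/-- The divergence of a vector field on `ℝ^d`. -/
def divergence {d : ℕ} (φ : Euc d → Euc d) (x : Euc d) : ℝ :=
  ∑ i : Fin d, (fderiv ℝ φ x (EuclideanSpace.single i 1)) i

/-- The test fields for the total variation in `Ω`: the compactly supported `C^1` vector fields in
`Ω` whose Euclidean length is at most `1` everywhere. -/
def IsTestField {d : ℕ} (Ω : Set (Euc d)) (φ : Euc d → Euc d) : Prop :=
  ContDiff ℝ 1 φ ∧ HasCompactSupport φ ∧ tsupport φ ⊆ Ω ∧ ∀ x, ‖φ x‖ ≤ 1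

/-- The total variation `‖Du‖(Ω) = ∫_Ω |Du|` of `u` in `Ω`, as an extended nonnegative number: the
supremum of `∫_Ω u div φ` over all test fields `φ` (a set of numbers symmetric about `0`). -/
def totalVariation {d : ℕ} (Ω : Set (Euc d)) (u : Euc d → ℝ) : ℝ≥0∞ :=
  ⨆ (φ : Euc d → Euc d) (_ : IsTestField Ω φ),
    ENNReal.ofReal (∫ x in Ω, u x * divergence φ x)

/-- `u ∈ BV(Ω)`. -/
def MemBV {d : ℕ} (Ω : Set (Euc d)) (u : Euc d → ℝ) : Prop :=
  IntegrableOn u Ω volume ∧ totalVariation Ω u < ⊤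

/-- The number `c` is the trace of `u` at the boundary point `x` of `Ω`: the mean value of `|u - c|`
over `B(x, ρ) ∩ Ω` tends to `0` as `ρ → 0+`. -/
def HasTraceAt {d : ℕ} (Ω : Set (Euc d)) (u : Euc d → ℝ) (x : Euc d) (c : ℝ) : Prop :=
  Tendsto (fun ρ : ℝ => ⨍ y in ball x ρ ∩ Ω, |u y - c|) (𝓝[>] 0) (𝓝 0)

open Classical in
/-- The trace of `u` on the boundary of `Ω`. For `u ∈ BV(Ω)` on a bounded Lipschitz domain it exists
at almost every boundary point with respect to the surface measure; elsewhere the value is `0`. -/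
def bvTrace {d : ℕ} (Ω : Set (Euc d)) (u : Euc d → ℝ) (x : Euc d) : ℝ :=
  if h : ∃ c : ℝ, HasTraceAt Ω u x c then h.choose else 0

/-- The trace at a boundary point is unique. -/
theorem HasTraceAt.unique {d : ℕ} {Ω : Set (Euc d)} {u : Euc d → ℝ} {x : Euc d} {a b : ℝ}
    (hΩ : IsOpen Ω) (hu : IntegrableOn u Ω volume) (hx : x ∈ closure Ω)
    (ha : HasTraceAt Ω u x a) (hb : HasTraceAt Ω u x b) : a = b := by
  have key : ∀ ρ : ℝ, 0 < ρ → |a - b| ≤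
      (⨍ y in ball x ρ ∩ Ω, |u y - a|) + ⨍ y in ball x ρ ∩ Ω, |u y - b| := by
    intro ρ hρ
    have hne : (ball x ρ ∩ Ω).Nonempty :=
      mem_closure_iff.1 hx _ isOpen_ball (mem_ball_self hρ)
    have hpos : 0 < volume (ball x ρ ∩ Ω) := (isOpen_ball.inter hΩ).measure_pos volume hne
    have hfin : volume (ball x ρ ∩ Ω) < ⊤ :=
      (measure_mono inter_subset_left).trans_lt measure_ball_lt_top
    have hi : ∀ c : ℝ, IntegrableOn (fun y => |u y - c|) (ball x ρ ∩ Ω) volume := fun c =>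
      ((hu.mono_set inter_subset_right).sub (integrableOn_const hfin.ne)).abs
    have hm : 0 < volume.real (ball x ρ ∩ Ω) := ENNReal.toReal_pos hpos.ne' hfin.ne
    rw [setAverage_eq, setAverage_eq, ← smul_add, ← integral_add (hi a) (hi b), smul_eq_mul,
      ← div_eq_inv_mul, le_div_iff₀ hm]
    have h := setIntegral_mono_on (μ := volume) (s := ball x ρ ∩ Ω) (f := fun _ => |a - b|)
      (g := fun y => |u y - a| + |u y - b|) (integrableOn_const hfin.ne)
      ((hi a).add (hi b)) (isOpen_ball.inter hΩ).measurableSet (fun y _ => by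
        have := abs_sub_le a (u y) b
        rwa [abs_sub_comm a (u y)] at this)
    rw [setIntegral_const, smul_eq_mul] at h
    linarith
  have hlim := ha.add hb
  rw [add_zero] at hlim
  have h0 : |a - b| ≤ 0 := ge_of_tendsto hlim
    (by filter_upwards [self_mem_nhdsWithin] with ρ hρ using key ρ hρ)
  exact sub_eq_zero.1 (abs_nonpos_iff.1 h0)

/-- `∫_{∂Ω} |u|`: the integral of the absolute value of the trace of `u` over the boundary of
`Ω ⊆ ℝ^(d+1)`, with respect to the `d`-dimensional Hausdorff measure (normalized so as to agree with
Lebesgue measure on `ℝ^d`). -/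
def boundaryIntegral {d : ℕ} (Ω : Set (Euc (d + 1))) (u : Euc (d + 1) → ℝ) : ℝ :=
  ∫ x in frontier Ω, |bvTrace Ω u x| ∂(Measure.euclideanHausdorffMeasure d)

/-- The trace inequality on `BV(Ω)` with leading constant one and constant `C`. -/
def TraceInequality {d : ℕ} (Ω : Set (Euc (d + 1))) (C : ℝ) : Prop :=
  ∀ u : Euc (d + 1) → ℝ, MemBV Ω u →
    boundaryIntegral Ω u ≤ (totalVariation Ω u).toReal + C * ∫ x in Ω, |u x|

/-- The profile `ψ(t) = |t|^{1+α} / (1+α)`. -/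
def profile (α t : ℝ) : ℝ := |t| ^ (1 + α) / (1 + α)

/-- `Ω` is a `C^{1,α}` domain with `0 ∈ ∂Ω` whose part below the level `x_N = η` is the region above
the graph of `x_N = |x'|^{1+α} / (1+α)`. -/
structure IsPowerDomain {d : ℕ} (α η : ℝ) (Ω : Set (Euc (d + 1))) : Prop where
  domain : IsC1HolderDomain α Ω
  zero_mem : (0 : Euc (d + 1)) ∈ frontier Ω
  below : Ω ∩ {x | vert x < η} = {x | profile α ‖horiz x‖ < vert x ∧ vert x < η}

/-- The region `E = {ψ(|x'|) < x_N < ψ(r)}`. -/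
def testRegion (d : ℕ) (α r : ℝ) : Set (Euc (d + 1)) :=
  {x | profile α ‖horiz x‖ < vert x ∧ vert x < profile α r}

/-- The characteristic function `χ_E` of the region `E = {ψ(|x'|) < x_N < ψ(r)}`. -/
def testFun (d : ℕ) (α r : ℝ) : Euc (d + 1) → ℝ := (testRegion d α r).indicator (fun _ => 1)

end

/-! Write d = N - 1. The horizontal plane at height ψ(r) cuts off from Ω a small bowl E bounded by a
flat lid, which lies inside Ω apart from its rim, and by a curved bottom, which lies in ∂Ω. Only the
lid contributes to the total variation of χ_E, and only the bottom contributes to the boundary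
integral. Both project onto the ball of radius r in ℝ^d, so their areas agree to leading order.
Since |∇ψ(|x'|)| = |x'|^α, the bottom exceeds the lid by an amount of exact order r^(d+2α), whereas
the volume of E is of order r^(d+1+α). As α < 1, the first order dominates, and no multiple of the
volume can compensate for the excess. At α = 1 the two orders would coincide.

The lid: against a test field, χ_E sees only the flux through the lid
(`IsPowerDomain.integral_testFun_mul_divergence`), because the field vanishes on ∂Ω. Fields bounded
by 1 give at most the area of the lid, and vertical cutoff fields approach it. The bottom: the trace
is locally constant off the rim, so the boundary integral is the Hausdorff measure of a graph. The
area formula `euclideanHausdorffMeasure_graph` computes it by local comparison with tangent planes,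
and `abs_graph_area_sub_le` expands it. The comparison of orders is `eventually_lt_of_expansion`.
Existence of bounded examples comes from a body of revolution, `spindle`. -/

noncomputable section

/-! ### Coordinates (x', x_N) and Fubini -/

/-- The splitting `x ↦ (x', x_N)` as a continuous linear equivalence. -/
def splitL (d : ℕ) : Euc (d + 1) ≃L[ℝ] Euc d × ℝ :=
  LinearEquiv.toContinuousLinearEquiv
    { toFun := fun x => (horiz x, vert x)
      invFun := fun p => WithLp.toLp 2 (Fin.snoc (α := fun _ => ℝ) (WithLp.ofLp p.1) p.2)
      map_add' := fun x y => rfl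
      map_smul' := fun c x => rfl
      left_inv := fun x => by
        ext i
        refine Fin.lastCases ?_ (fun j => ?_) i <;> simp [horiz, vert]
      right_inv := fun p => by
        ext <;> simp [horiz, vert] }

theorem splitL_apply {d : ℕ} (x : Euc (d + 1)) : splitL d x = (horiz x, vert x) := rfl

/-- The point `(z, t)` of `ℝ^(d+1)`. -/
def mkPoint {d : ℕ} (z : Euc d) (t : ℝ) : Euc (d + 1) := (splitL d).symm (z, t)

@[simp] theorem splitL_mkPoint {d : ℕ} (z : Euc d) (t : ℝ) : splitL d (mkPoint z t) = (z, t) :=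
  (splitL d).apply_symm_apply _

@[simp] theorem horiz_mkPoint {d : ℕ} (z : Euc d) (t : ℝ) : horiz (mkPoint z t) = z :=
  congrArg Prod.fst (splitL_mkPoint z t)

@[simp] theorem vert_mkPoint {d : ℕ} (z : Euc d) (t : ℝ) : vert (mkPoint z t) = t :=
  congrArg Prod.snd (splitL_mkPoint z t)

@[simp] theorem mkPoint_horiz_vert {d : ℕ} (x : Euc (d + 1)) : mkPoint (horiz x) (vert x) = x :=
  (splitL d).symm_apply_apply x

theorem mkPoint_zero_zero {d : ℕ} : mkPoint (0 : Euc d) 0 = 0 := (splitL d).symm.map_zero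

@[simp] theorem vert_zero {d : ℕ} : vert (0 : Euc (d + 1)) = 0 := rfl

@[simp] theorem horiz_neg {d : ℕ} (x : Euc (d + 1)) : horiz (-x) = -horiz x := rfl

@[simp] theorem vert_neg {d : ℕ} (x : Euc (d + 1)) : vert (-x) = -vert x := rfl

theorem vert_add {d : ℕ} (x y : Euc (d + 1)) : vert (x + y) = vert x + vert y := rfl

theorem horiz_sub {d : ℕ} (x y : Euc (d + 1)) : horiz (x - y) = horiz x - horiz y := rfl

theorem vert_smul {d : ℕ} (c : ℝ) (x : Euc (d + 1)) : vert (c • x) = c * vert x := rfl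

theorem mkPoint_sub {d : ℕ} (z w : Euc d) (s t : ℝ) : mkPoint z s - mkPoint w t = mkPoint (z - w) (s - t) :=
  ((splitL d).symm.map_sub (z, s) (w, t)).symm

theorem contDiff_horiz {d : ℕ} {n : WithTop ℕ∞} : ContDiff ℝ n (horiz (d := d)) :=
  contDiff_fst.comp (splitL d).contDiff

theorem contDiff_vert {d : ℕ} {n : WithTop ℕ∞} : ContDiff ℝ n (vert (d := d)) :=
  contDiff_snd.comp (splitL d).contDiff

@[fun_prop] theorem continuous_horiz {d : ℕ} : Continuous (horiz (d := d)) :=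
  continuous_fst.comp (splitL d).continuous

@[fun_prop] theorem continuous_vert {d : ℕ} : Continuous (vert (d := d)) :=
  continuous_snd.comp (splitL d).continuous

@[fun_prop] theorem Continuous.mkPoint {X : Type*} [TopologicalSpace X] {d : ℕ} {f : X → Euc d}
    {g : X → ℝ} (hf : Continuous f) (hg : Continuous g) : Continuous fun x => mkPoint (f x) (g x) :=
  (splitL d).symm.continuous.comp (hf.prodMk hg)

theorem norm_sq_eq_horiz_vert {d : ℕ} (x : Euc (d + 1)) :
    ‖x‖ ^ 2 = ‖horiz x‖ ^ 2 + vert x ^ 2 := by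
  simp [EuclideanSpace.norm_sq_eq, Fin.sum_univ_castSucc, horiz, vert]

theorem norm_horiz_le {d : ℕ} (x : Euc (d + 1)) : ‖horiz x‖ ≤ ‖x‖ := by
  refine le_of_sq_le_sq ?_ (norm_nonneg _)
  nlinarith [norm_sq_eq_horiz_vert x, sq_nonneg (vert x)]

theorem abs_vert_le {d : ℕ} (x : Euc (d + 1)) : |vert x| ≤ ‖x‖ := by
  refine abs_le_of_sq_le_sq ?_ (norm_nonneg _)
  nlinarith [norm_sq_eq_horiz_vert x, sq_nonneg ‖horiz x‖]

theorem norm_le_horiz_add_vert {d : ℕ} (x : Euc (d + 1)) : ‖x‖ ≤ ‖horiz x‖ + |vert x| := by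
  refine le_of_sq_le_sq ?_ (by positivity)
  nlinarith [norm_sq_eq_horiz_vert x, sq_abs (vert x),
    mul_nonneg (norm_nonneg (horiz x)) (abs_nonneg (vert x))]

theorem measurePreserving_splitL (d : ℕ) : MeasurePreserving (splitL d) volume volume := by
  have h1 := PiLp.volume_preserving_ofLp (Fin (d + 1))
  have h2 := volume_preserving_piFinSuccAbove (fun _ : Fin (d + 1) => ℝ) (Fin.last d)
  have h3 : MeasurePreserving (Prod.map (id : ℝ → ℝ) (WithLp.toLp 2 : (Fin d → ℝ) → Euc d))
      volume volume := (MeasurePreserving.id volume).prod (PiLp.volume_preserving_toLp (Fin d))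
  have h4 : MeasurePreserving (Prod.swap : ℝ × Euc d → Euc d × ℝ) volume volume :=
    Measure.measurePreserving_swap
  have heq : ⇑(splitL d) = Prod.swap ∘ Prod.map (id : ℝ → ℝ) (WithLp.toLp 2 : (Fin d → ℝ) → Euc d) ∘
      MeasurableEquiv.piFinSuccAbove (fun _ : Fin (d + 1) => ℝ) (Fin.last d) ∘ WithLp.ofLp := by
    funext x
    refine Prod.ext ?_ rfl
    ext i
    simp [splitL_apply, horiz, Fin.init]
  rw [heq]
  exact h4.comp (h3.comp (h2.comp h1))

theorem integral_eq_integral_mkPoint {d : ℕ} (F : Euc (d + 1) → ℝ) :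
    ∫ x, F x = ∫ p : Euc d × ℝ, F (mkPoint p.1 p.2) := by
  rw [← (measurePreserving_splitL d).integral_comp
    (splitL d).toHomeomorph.measurableEmbedding (fun p => F (mkPoint p.1 p.2))]
  simp [splitL_apply]

theorem integrable_mkPoint {d : ℕ} {F : Euc (d + 1) → ℝ} (hF : Integrable F) :
    Integrable fun p : Euc d × ℝ => F (mkPoint p.1 p.2) := by
  rw [← (measurePreserving_splitL d).integrable_comp_emb
    (splitL d).toHomeomorph.measurableEmbedding]
  simpa [Function.comp_def, splitL_apply] using hF

/-! ### The area formula for C^1 graphs -/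

open scoped NNReal in
/-- If `g` is `K`-Lipschitz relative to the injective map `h` on `s`, then the `d`-dimensional
measure of `g(s)` is at most `K ^ d` times that of `h(s)`. -/
theorem euclideanHausdorffMeasure_image_le_mul {X Y Z : Type*} [MetricSpace Y] [MeasurableSpace Y]
    [BorelSpace Y] [MetricSpace Z] [MeasurableSpace Z] [BorelSpace Z] (d : ℕ) {g : X → Y}
    {h : X → Z} (hh : Function.Injective h) {s : Set X} {K : ℝ≥0}
    (H : ∀ x ∈ s, ∀ y ∈ s, dist (g x) (g y) ≤ K * dist (h x) (h y)) :
    Measure.euclideanHausdorffMeasure d (g '' s) ≤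
      (K : ℝ≥0∞) ^ d * Measure.euclideanHausdorffMeasure d (h '' s) := by
  rcases s.eq_empty_or_nonempty with rfl | ⟨x₀, -⟩
  · simp
  have : Nonempty X := ⟨x₀⟩
  have hinv : ∀ x, Function.invFun h (h x) = x := Function.leftInverse_invFun hh
  have hL : LipschitzOnWith K (g ∘ Function.invFun h) (h '' s) := by
    refine LipschitzOnWith.of_dist_le_mul ?_
    rintro _ ⟨x, hx, rfl⟩ _ ⟨y, hy, rfl⟩
    simpa [hinv] using H x hx y hy
  have himg : (g ∘ Function.invFun h) '' (h '' s) = g '' s := by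
    rw [image_image]
    simp [hinv]
  have := hL.hausdorffMeasure_image_le (d := d) (Nat.cast_nonneg d)
  rw [himg, ENNReal.rpow_natCast] at this
  simp only [Measure.euclideanHausdorffMeasure_def, Measure.smul_apply, ENNReal.smul_def,
    smul_eq_mul]
  rw [mul_left_comm]
  gcongr

/-- A measure is bounded by another one if this holds locally for measurable sets. -/
theorem MeasureTheory.Measure.le_of_forall_nhds_le {X : Type*} [TopologicalSpace X]
    [SecondCountableTopology X] [MeasurableSpace X] [OpensMeasurableSpace X] {μ ν : Measure X}
    (H : ∀ x, ∃ U ∈ 𝓝 x, ∀ A ⊆ U, MeasurableSet A → μ A ≤ ν A) : μ ≤ ν := by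
  choose U hU hA using H
  obtain ⟨t, htc, ht⟩ := TopologicalSpace.countable_cover_nhds
    (fun x => interior_mem_nhds.2 (hU x))
  rcases isEmpty_or_nonempty X with hX | hX
  · refine Measure.le_iff.2 fun s _ => ?_
    simp [Set.eq_empty_of_isEmpty s]
  have htne : t.Nonempty := by
    rw [Set.nonempty_iff_ne_empty]
    rintro rfl
    obtain ⟨x⟩ := hX
    have : x ∈ ⋃ x ∈ (∅ : Set X), interior (U x) := by rw [ht]; trivial
    simp at this
  -- The countable subcover is enumerated and made disjoint, so that the local bounds add up by
  -- countable additivity.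
  obtain ⟨e, rfl⟩ := htc.exists_eq_range htne
  refine Measure.le_iff.2 fun s hs => ?_
  have hcov : ⋃ n, interior (U (e n)) = univ := by simpa [biUnion_range] using ht
  set D : ℕ → Set X := disjointed fun n => interior (U (e n)) with hD
  have hDm : ∀ n, MeasurableSet (D n) :=
    MeasurableSet.disjointed fun n => isOpen_interior.measurableSet
  have hdec : s = ⋃ n, s ∩ D n := by
    rw [← inter_iUnion, hD, iUnion_disjointed, hcov, inter_univ]
  have hdisj : Pairwise (Function.onFun Disjoint fun n => s ∩ D n) := fun i j hij =>
    (disjoint_disjointed _ hij).mono inter_subset_right inter_subset_right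
  rw [hdec, measure_iUnion hdisj fun n => hs.inter (hDm n),
    measure_iUnion hdisj fun n => hs.inter (hDm n)]
  refine ENNReal.tsum_le_tsum fun n => hA (e n) _ ?_ (hs.inter (hDm n))
  exact inter_subset_right.trans ((disjointed_subset _ n).trans interior_subset)

/-- The linear map `z ↦ (z, A z)`. -/
def graphLinear {d : ℕ} (A : Euc d →L[ℝ] ℝ) : Euc d →ₗ[ℝ] Euc (d + 1) :=
  (splitL d).symm.toLinearMap.comp (LinearMap.id.prod A.toLinearMap)

theorem graphLinear_apply {d : ℕ} (A : Euc d →L[ℝ] ℝ) (z : Euc d) :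
    graphLinear A z = mkPoint z (A z) := rfl

theorem graphLinear_injective {d : ℕ} (A : Euc d →L[ℝ] ℝ) :
    Function.Injective (graphLinear A) := fun z w h => by
  simpa [graphLinear_apply] using congrArg horiz h

theorem inner_mkPoint_mkPoint {d : ℕ} (z w : Euc d) (s t : ℝ) :
    inner ℝ (mkPoint z s) (mkPoint w t) = inner ℝ z w + s * t := by
  have h : ∀ x y : Euc (d + 1), inner ℝ x y = inner ℝ (horiz x) (horiz y) + vert x * vert y := by
    intro x y
    simp [PiLp.inner_apply, Fin.sum_univ_castSucc, horiz, vert, mul_comm]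
  simp [h]

/-- If w represents A, the Gram matrix of the images of the standard basis is I + w wᵀ, whose
determinant is 1 + |w|² by the matrix determinant lemma. -/
theorem normDet_graphLinear {d : ℕ} (A : Euc d →L[ℝ] ℝ) :
    (graphLinear A).normDet = Real.sqrt (1 + ‖A‖ ^ 2) := by
  obtain ⟨w, rfl⟩ := (InnerProductSpace.toDual ℝ (Euc d)).surjective A
  rw [LinearIsometryEquiv.norm_map]
  have h := (graphLinear (InnerProductSpace.toDual ℝ (Euc d) w)).normDet_sq_eq_det_gram
    (EuclideanSpace.basisFun (Fin d) ℝ)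
  have hg : (Matrix.gram ℝ fun i => graphLinear (InnerProductSpace.toDual ℝ (Euc d) w)
      (EuclideanSpace.basisFun (Fin d) ℝ i)) =
      1 + Matrix.replicateCol Unit (WithLp.ofLp w) * Matrix.replicateRow Unit (WithLp.ofLp w) := by
    ext i j
    simp [Matrix.gram_apply, graphLinear_apply, inner_mkPoint_mkPoint, Matrix.mul_apply, Matrix.one_apply,
      EuclideanSpace.inner_single_right, eq_comm]
  rw [hg, Matrix.det_one_add_replicateCol_mul_replicateRow] at h
  rw [← Real.sqrt_sq (LinearMap.normDet_nonneg (graphLinear (InnerProductSpace.toDual ℝ (Euc d) w)))]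
  congr 1
  simp only [RCLike.ofReal_real_eq_id, id] at h
  rw [h, EuclideanSpace.norm_sq_eq]
  simp [dotProduct, sq]

theorem euclideanHausdorffMeasure_graphLinear_image {d : ℕ} (A : Euc d →L[ℝ] ℝ) (s : Set (Euc d)) :
    Measure.euclideanHausdorffMeasure d (graphLinear A '' s) =
      ENNReal.ofReal (Real.sqrt (1 + ‖A‖ ^ 2)) * volume s := by
  have := (graphLinear A).euclideanHausdorffMeasure_image_eq_normDet_mul_volume s
  rwa [finrank_euclideanSpace_fin, normDet_graphLinear] at this

/-- Turns an additive error in the norm of the derivative into a factor in the area density. -/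
theorem sqrt_one_add_sq_le {a b ε : ℝ} (hε : 0 ≤ ε) (ha : 0 ≤ a) (h : a ≤ b + ε) :
    Real.sqrt (1 + a ^ 2) ≤ (1 + ε) * Real.sqrt (1 + b ^ 2) := by
  have h1 : 1 ≤ Real.sqrt (1 + b ^ 2) := Real.one_le_sqrt.2 (by nlinarith)
  have h2 : b ≤ Real.sqrt (1 + b ^ 2) := Real.le_sqrt_of_sq_le (by linarith)
  have h3 := Real.sq_sqrt (show 0 ≤ 1 + b ^ 2 by positivity)
  refine Real.sqrt_le_iff.2 ⟨by positivity, ?_⟩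
  have : a ^ 2 ≤ (b + ε) ^ 2 := by gcongr
  nlinarith [mul_nonneg hε (sub_nonneg.2 h2), mul_nonneg hε (sub_nonneg.2 h1), sq_nonneg ε,
    mul_nonneg (sq_nonneg ε) (sub_nonneg.2 h1)]

theorem measurableEmbedding_graph {d : ℕ} {f : Euc d → ℝ} (hf : Continuous f) :
    MeasurableEmbedding fun z => mkPoint z (f z) := by
  refine Topology.IsClosedEmbedding.measurableEmbedding ?_
  exact Function.LeftInverse.isClosedEmbedding (f := horiz) (fun z => by simp)
    continuous_horiz (continuous_id.mkPoint hf)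

/-- Graph and tangent plane differ by at most ε|z - w| in their increments. Projection to ℝ^d does
not increase distances, so |z - w| is bounded by the distance on either surface and the error
becomes a factor 1 + ε. -/
theorem dist_mkPoint_le_of_approximates {d : ℕ} {f : Euc d → ℝ} {A : Euc d →L[ℝ] ℝ} {s : Set (Euc d)}
    {ε : NNReal} (h : ApproximatesLinearOn f A s ε) {z w : Euc d} (hz : z ∈ s) (hw : w ∈ s) :
    dist (mkPoint z (f z)) (mkPoint w (f w)) ≤ (1 + ε : NNReal) * dist (graphLinear A z) (graphLinear A w) ∧
    dist (graphLinear A z) (graphLinear A w) ≤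
      (1 + ε : NNReal) * dist (mkPoint z (f z)) (mkPoint w (f w)) := by
  have h1 := h z hz w hw
  have h2 : dist (mkPoint z (f z) - mkPoint w (f w)) (graphLinear A z - graphLinear A w) ≤
      ε * ‖z - w‖ := by
    rw [dist_eq_norm, ← map_sub, mkPoint_sub, graphLinear_apply, mkPoint_sub, sub_self]
    refine (norm_le_horiz_add_vert _).trans ?_
    simpa using h1
  have h3 : ‖z - w‖ ≤ ‖mkPoint z (f z) - mkPoint w (f w)‖ := by
    simpa [horiz_sub] using norm_horiz_le (mkPoint z (f z) - mkPoint w (f w))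
  have h4 : ‖z - w‖ ≤ ‖graphLinear A z - graphLinear A w‖ := by
    simpa [horiz_sub, graphLinear_apply] using norm_horiz_le (graphLinear A z - graphLinear A w)
  rw [dist_eq_norm] at h2
  rw [dist_eq_norm, dist_eq_norm]
  have h5 := norm_le_norm_add_norm_sub' (mkPoint z (f z) - mkPoint w (f w))
    (graphLinear A z - graphLinear A w)
  have h6 := norm_le_norm_add_norm_sub (mkPoint z (f z) - mkPoint w (f w))
    (graphLinear A z - graphLinear A w)
  push_cast
  constructor <;> nlinarith [ε.2, mul_le_mul_of_nonneg_left h3 ε.2, mul_le_mul_of_nonneg_left h4 ε.2]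

/-- The map between graph and tangent plane is (1 + ε)-Lipschitz in both directions, which costs (1
+ ε)^d in d-dimensional measure. Replacing the density at z₀ by the density at z costs one more
factor, hence the exponent d + 1. -/
theorem exists_nhds_graph_measure_le {d : ℕ} {f : Euc d → ℝ} (hf : ContDiff ℝ 1 f) (z₀ : Euc d)
    {ε : NNReal} (hε : 0 < ε) :
    ∃ U ∈ 𝓝 z₀, ∀ s ⊆ U, MeasurableSet s →
      Measure.euclideanHausdorffMeasure d ((fun z => mkPoint z (f z)) '' s) ≤
        ((1 + ε : NNReal) : ℝ≥0∞) ^ (d + 1) *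
          ∫⁻ z in s, ENNReal.ofReal (Real.sqrt (1 + ‖fderiv ℝ f z‖ ^ 2)) ∧
      ∫⁻ z in s, ENNReal.ofReal (Real.sqrt (1 + ‖fderiv ℝ f z‖ ^ 2)) ≤
        ((1 + ε : NNReal) : ℝ≥0∞) ^ (d + 1) *
          Measure.euclideanHausdorffMeasure d ((fun z => mkPoint z (f z)) '' s) := by
  set A := fderiv ℝ f z₀ with hA
  obtain ⟨U, hU, happ⟩ := (hf.contDiffAt.hasStrictFDerivAt (x := z₀)
    one_ne_zero).approximates_deriv_on_nhds (c := ε) (Or.inr hε)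
  have hV : {z | dist (fderiv ℝ f z) A < ε} ∈ 𝓝 z₀ :=
    (hf.continuous_fderiv one_ne_zero).continuousAt (ball_mem_nhds _ (NNReal.coe_pos.2 hε))
  refine ⟨_, inter_mem hU hV, fun s hs hsm => ?_⟩
  have hd : ∀ z ∈ s, ∀ w ∈ s, _ := fun z hz w hw =>
    dist_mkPoint_le_of_approximates happ (hs hz).1 (hs hw).1
  have m1 := euclideanHausdorffMeasure_image_le_mul d (graphLinear_injective A)
    (g := fun z => mkPoint z (f z)) fun z hz w hw => (hd z hz w hw).1
  have m2 := euclideanHausdorffMeasure_image_le_mul d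
    (measurableEmbedding_graph hf.continuous).injective (g := graphLinear A)
    fun z hz w hw => (hd z hz w hw).2
  rw [euclideanHausdorffMeasure_graphLinear_image] at m1 m2
  have hJ1 : ∀ z ∈ s, ENNReal.ofReal (Real.sqrt (1 + ‖fderiv ℝ f z‖ ^ 2)) ≤
      ((1 + ε : NNReal) : ℝ≥0∞) * ENNReal.ofReal (Real.sqrt (1 + ‖A‖ ^ 2)) := by
    intro z hz
    rw [← ENNReal.ofReal_coe_nnreal, ← ENNReal.ofReal_mul (by positivity)]
    refine ENNReal.ofReal_le_ofReal ?_
    push_cast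
    refine sqrt_one_add_sq_le ε.2 (norm_nonneg _) ?_
    have := (hs hz).2
    rw [mem_ofPred_eq, dist_eq_norm] at this
    linarith [norm_le_norm_add_norm_sub' (fderiv ℝ f z) A]
  have hJ2 : ∀ z ∈ s, ENNReal.ofReal (Real.sqrt (1 + ‖A‖ ^ 2)) ≤
      ((1 + ε : NNReal) : ℝ≥0∞) * ENNReal.ofReal (Real.sqrt (1 + ‖fderiv ℝ f z‖ ^ 2)) := by
    intro z hz
    rw [← ENNReal.ofReal_coe_nnreal, ← ENNReal.ofReal_mul (by positivity)]
    refine ENNReal.ofReal_le_ofReal ?_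
    push_cast
    refine sqrt_one_add_sq_le ε.2 (norm_nonneg _) ?_
    have := (hs hz).2
    rw [mem_ofPred_eq, dist_eq_norm] at this
    linarith [norm_le_norm_add_norm_sub (fderiv ℝ f z) A]
  constructor
  · refine m1.trans ?_
    rw [pow_succ _ d, mul_assoc]
    refine mul_le_mul_right ?_ _
    rw [← lintegral_const_mul' _ _ ENNReal.coe_ne_top, ← setLIntegral_const]
    exact setLIntegral_mono' hsm hJ2
  · refine (setLIntegral_mono' hsm hJ1).trans ?_
    rw [setLIntegral_const, mul_assoc, pow_succ' _ d, mul_assoc]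
    gcongr

theorem le_of_forall_one_add_pow_mul_le {a b : ℝ≥0∞} (n : ℕ)
    (h : ∀ ε : NNReal, 0 < ε → a ≤ ((1 + ε : NNReal) : ℝ≥0∞) ^ n * b) : a ≤ b := by
  have h1 : Tendsto (fun ε : NNReal => ((1 + ε : NNReal) : ℝ≥0∞) ^ n) (𝓝[>] 0) (𝓝 1) := by
    have : Tendsto (fun ε : NNReal => (1 + ε) ^ n) (𝓝 0) (𝓝 ((1 + 0) ^ n)) :=
      (by fun_prop : Continuous fun ε : NNReal => (1 + ε) ^ n).tendsto 0
    simp only [add_zero, one_pow] at this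
    have h := (ENNReal.tendsto_coe.2 this).mono_left (nhdsWithin_le_nhds (s := Ioi 0))
    simpa only [ENNReal.coe_pow, ENNReal.coe_one] using h
  have h2 := ENNReal.Tendsto.mul_const (b := b) h1 (Or.inl one_ne_zero)
  rw [one_mul] at h2
  exact ge_of_tendsto h2 (by filter_upwards [self_mem_nhdsWithin] with ε hε using h ε hε)

/-- The **area formula** for the graph of a `C^1` function. -/
theorem euclideanHausdorffMeasure_graph {d : ℕ} {f : Euc d → ℝ} (hf : ContDiff ℝ 1 f)
    {s : Set (Euc d)} (hs : MeasurableSet s) :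
    Measure.euclideanHausdorffMeasure d ((fun z => mkPoint z (f z)) '' s) =
      ∫⁻ z in s, ENNReal.ofReal (Real.sqrt (1 + ‖fderiv ℝ f z‖ ^ 2)) := by
  set J : Euc d → ℝ≥0∞ := fun z => ENNReal.ofReal (Real.sqrt (1 + ‖fderiv ℝ f z‖ ^ 2)) with hJ
  -- Both sides of the formula are measures in s, so the local two-sided estimates globalize before
  -- ε tends to 0.
  set μ : Measure (Euc d) := (Measure.euclideanHausdorffMeasure d).comap fun z => mkPoint z (f z)
  have hμ : ∀ s, μ s = Measure.euclideanHausdorffMeasure d ((fun z => mkPoint z (f z)) '' s) :=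
    fun s => (measurableEmbedding_graph hf.continuous).comap_apply _ s
  have hν : ∀ s, MeasurableSet s → volume.withDensity J s = ∫⁻ z in s, J z :=
    fun s hs => withDensity_apply _ hs
  rw [← hμ, ← hν s hs]
  apply le_antisymm
  · refine le_of_forall_one_add_pow_mul_le (d + 1) fun ε hε => ?_
    have : μ ≤ (((1 + ε : NNReal) : ℝ≥0∞) ^ (d + 1)) • volume.withDensity J := by
      refine Measure.le_of_forall_nhds_le fun z => ?_
      obtain ⟨U, hU, h⟩ := exists_nhds_graph_measure_le hf z hε
      refine ⟨U, hU, fun A hA hAm => ?_⟩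
      rw [hμ, Measure.smul_apply, hν A hAm, smul_eq_mul]
      exact (h A hA hAm).1
    simpa using this s
  · refine le_of_forall_one_add_pow_mul_le (d + 1) fun ε hε => ?_
    have : volume.withDensity J ≤ (((1 + ε : NNReal) : ℝ≥0∞) ^ (d + 1)) • μ := by
      refine Measure.le_of_forall_nhds_le fun z => ?_
      obtain ⟨U, hU, h⟩ := exists_nhds_graph_measure_le hf z hε
      refine ⟨U, hU, fun A hA hAm => ?_⟩
      rw [hν A hAm, Measure.smul_apply, hμ, smul_eq_mul]
      exact (h A hA hAm).2
    simpa using this s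

/-! ### The profile and its radial integrals -/

theorem profile_norm {d : ℕ} (α : ℝ) (z : Euc d) : profile α ‖z‖ = ‖z‖ ^ (1 + α) / (1 + α) := by
  rw [profile, abs_norm]

theorem profile_zero {α : ℝ} (hα : 0 < α) : profile α 0 = 0 := by
  rw [profile, abs_zero, Real.zero_rpow (by linarith), zero_div]

theorem profile_nonneg {α : ℝ} (hα : 0 < α) (t : ℝ) : 0 ≤ profile α t := by
  unfold profile; positivity

theorem profile_lt_profile {α : ℝ} (hα : 0 < α) {s t : ℝ} (hs : 0 ≤ s) (ht : 0 ≤ t) :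
    profile α s < profile α t ↔ s < t := by
  rw [profile, profile, div_lt_div_iff_of_pos_right (by linarith), abs_of_nonneg hs,
    abs_of_nonneg ht, Real.rpow_lt_rpow_iff hs ht (by linarith)]

theorem profile_le_profile {α : ℝ} (hα : 0 < α) {s t : ℝ} (hs : 0 ≤ s) (ht : 0 ≤ t) :
    profile α s ≤ profile α t ↔ s ≤ t := by
  rw [← not_lt, profile_lt_profile hα ht hs, not_lt]

theorem continuous_profile {α : ℝ} (hα : 0 < α) : Continuous (profile α) := by
  unfold profile
  exact ((continuous_abs).rpow_const fun _ => Or.inr (by linarith)).div_const _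

theorem contDiff_profile_norm {d : ℕ} {α : ℝ} (hα : 0 < α) :
    ContDiff ℝ 1 fun z : Euc d => profile α ‖z‖ := by
  simp only [profile_norm]
  exact (contDiff_norm_rpow (by linarith)).div_const _

/-- At the origin the formula holds whatever value `0 ^ (α - 1)` takes, since `innerSL ℝ 0`
vanishes. -/
theorem fderiv_profile_norm {d : ℕ} {α : ℝ} (hα : 0 < α) (z : Euc d) :
    fderiv ℝ (fun z : Euc d => profile α ‖z‖) z = ‖z‖ ^ (α - 1) • innerSL ℝ z := by
  simp only [profile_norm]
  have h := (hasFDerivAt_norm_rpow z (show 1 < 1 + α by linarith)).mul_const (1 + α)⁻¹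
  simp only [div_eq_mul_inv]
  rw [h.fderiv, smul_smul]
  congr 1
  rw [show 1 + α - 2 = α - 1 by ring]
  field_simp

theorem norm_fderiv_profile_norm {d : ℕ} {α : ℝ} (hα : 0 < α) (z : Euc d) :
    ‖fderiv ℝ (fun z : Euc d => profile α ‖z‖) z‖ = ‖z‖ ^ α := by
  rw [fderiv_profile_norm hα, norm_smul, innerSL_apply_norm, Real.norm_of_nonneg (by positivity),
    ← Real.rpow_add_one' (norm_nonneg z) (by linarith)]
  ring_nf

/-- The integral of a power of the distance to the centre over a ball. -/
theorem integral_ball_norm_rpow {d : ℕ} (hd : 1 ≤ d) {p r : ℝ} (hp : 0 ≤ p) (hr : 0 ≤ r) :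
    ∫ z in ball (0 : Euc d) r, ‖z‖ ^ p =
      (d : ℝ) * unitBallVolume d / ((d : ℝ) + p) * r ^ ((d : ℝ) + p) := by
  have hd' : (1 : ℝ) ≤ d := by exact_mod_cast hd
  have : Nontrivial (Euc d) := by
    refine Module.nontrivial_of_finrank_pos (R := ℝ) ?_
    rw [finrank_euclideanSpace_fin]
    exact hd
  have h1 : ∫ z in ball (0 : Euc d) r, ‖z‖ ^ p =
      ∫ z : Euc d, (Iio r).indicator (fun y : ℝ => y ^ p) ‖z‖ := by
    rw [← integral_indicator measurableSet_ball]
    congr 1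
    ext z
    simp [indicator]
  rw [h1, integral_fun_norm_addHaar, finrank_euclideanSpace_fin]
  have h2 : ∫ y in Ioi (0 : ℝ), y ^ (d - 1) • (Iio r).indicator (fun y : ℝ => y ^ p) y =
      ∫ y in (0 : ℝ)..r, y ^ ((d : ℝ) - 1 + p) := by
    rw [intervalIntegral.integral_of_le hr, ← integral_Ioc_eq_integral_Ioo.symm,
      ← integral_indicator measurableSet_Ioi, ← integral_indicator measurableSet_Ioo]
    congr 1
    ext y
    by_cases hy : 0 < y
    · by_cases hy' : y < r
      · simp only [indicator, mem_Ioi, mem_Iio, mem_Ioo, hy, hy', and_self, if_true, smul_eq_mul]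
        rw [Real.rpow_add hy, ← Real.rpow_natCast, Nat.cast_sub hd, Nat.cast_one]
      · simp [indicator, hy']
    · simp [indicator, hy]
  rw [h2, integral_rpow (Or.inl (by linarith)), Real.zero_rpow (by linarith)]
  rw [nsmul_eq_mul, smul_eq_mul, show (d : ℝ) - 1 + p + 1 = d + p by ring, unitBallVolume]
  ring

theorem volume_real_ball {d : ℕ} (hd : 1 ≤ d) {r : ℝ} (hr : 0 ≤ r) :
    volume.real (ball (0 : Euc d) r) = unitBallVolume d * r ^ d := by
  rcases hr.eq_or_lt with rfl | hr
  · simp [(Nat.one_le_iff_ne_zero.1 hd)]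
  · rw [measureReal_def, Measure.addHaar_ball_of_pos _ _ hr, unitBallVolume, measureReal_def, ENNReal.toReal_mul,
      ENNReal.toReal_ofReal (by positivity), finrank_euclideanSpace_fin, mul_comm]

theorem integrableOn_ball_norm_rpow {d : ℕ} {p : ℝ} (hp : 0 ≤ p) (r : ℝ) :
    IntegrableOn (fun z : Euc d => ‖z‖ ^ p) (ball 0 r) :=
  ((continuous_norm.rpow_const fun _ => Or.inr hp).continuousOn.integrableOn_compact
    (isCompact_closedBall 0 r)).mono_set ball_subset_closedBall

theorem unitBallVolume_pos (d : ℕ) : 0 < unitBallVolume d :=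
  ENNReal.toReal_pos (measure_ball_pos _ _ one_pos).ne' measure_ball_lt_top.ne

/-- With q = √(1 + s), the difference 1 + s/2 - q equals (q - 1)²/2, and s = (q - 1)(q + 1) ≥ 2(q -
1). -/
theorem abs_sqrt_one_add_sub_le {s : ℝ} (hs : 0 ≤ s) :
    |Real.sqrt (1 + s) - (1 + s / 2)| ≤ s ^ 2 / 8 := by
  have h := Real.sq_sqrt (show 0 ≤ 1 + s by linarith)
  have h1 : 1 ≤ Real.sqrt (1 + s) := Real.one_le_sqrt.2 (by linarith)
  rw [abs_le]
  constructor <;> nlinarith [sq_nonneg (Real.sqrt (1 + s) - 1), mul_nonneg hs hs]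

/-- The surface area of the graph over the ball of radius `r`, up to an error of higher order. -/
theorem abs_graph_area_sub_le {d : ℕ} (hd : 1 ≤ d) {α : ℝ} (hα : 0 < α) {r : ℝ} (hr : 0 ≤ r) :
    |(∫ z in ball (0 : Euc d) r, Real.sqrt (1 + ‖z‖ ^ (2 * α))) -
      (unitBallVolume d * r ^ d +
        (d : ℝ) * unitBallVolume d / (2 * ((d : ℝ) + 2 * α)) * r ^ ((d : ℝ) + 2 * α))| ≤
      (d : ℝ) * unitBallVolume d / ((d : ℝ) + 4 * α) / 8 * r ^ ((d : ℝ) + 4 * α) := by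
  have hi := integrableOn_ball_norm_rpow (d := d) (show 0 ≤ 2 * α by positivity) r
  have hi4 := integrableOn_ball_norm_rpow (d := d) (show 0 ≤ 4 * α by positivity) r
  have hs : IntegrableOn (fun z : Euc d => Real.sqrt (1 + ‖z‖ ^ (2 * α))) (ball 0 r) := by
    refine ContinuousOn.integrableOn_compact (μ := volume) (isCompact_closedBall (0 : Euc d) r)
      (Continuous.continuousOn ?_) |>.mono_set ball_subset_closedBall
    exact (continuous_const.add
      (continuous_norm.rpow_const fun _ => Or.inr (by positivity))).sqrt
  have hc : IntegrableOn (fun _ : Euc d => (1 : ℝ)) (ball 0 r) :=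
    integrableOn_const measure_ball_lt_top.ne
  have hmain : unitBallVolume d * r ^ d +
      (d : ℝ) * unitBallVolume d / (2 * ((d : ℝ) + 2 * α)) * r ^ ((d : ℝ) + 2 * α) =
      ∫ z in ball (0 : Euc d) r, (1 + ‖z‖ ^ (2 * α) / 2) := by
    rw [integral_add hc (hi.div_const 2), integral_div, integral_ball_norm_rpow hd (by positivity) hr,
      setIntegral_const, volume_real_ball hd hr]
    simp only [smul_eq_mul]
    field_simp
  have hcd : IntegrableOn (fun z : Euc d => 1 + ‖z‖ ^ (2 * α) / 2) (ball 0 r) :=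
    hc.add (hi.div_const 2)
  rw [hmain, ← integral_sub hs hcd]
  have hb : (d : ℝ) * unitBallVolume d / ((d : ℝ) + 4 * α) / 8 * r ^ ((d : ℝ) + 4 * α) =
      ∫ z in ball (0 : Euc d) r, ‖z‖ ^ (4 * α) / 8 := by
    rw [integral_div, integral_ball_norm_rpow hd (by positivity) hr]
    ring
  rw [hb, ← Real.norm_eq_abs]
  refine norm_integral_le_of_norm_le (hi4.div_const 8) (ae_of_all _ fun z => ?_)
  have := abs_sqrt_one_add_sub_le (Real.rpow_nonneg (norm_nonneg z) (2 * α))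
  rw [← Real.rpow_natCast, ← Real.rpow_mul (norm_nonneg z)] at this
  rw [Real.norm_eq_abs]
  convert this using 3
  push_cast
  ring

/-! ### Total variation of the test function -/

section TestRegion

variable {d : ℕ} {α η r : ℝ} {Ω : Set (Euc (d + 1))}

theorem isOpen_testRegion (hα : 0 < α) : IsOpen (testRegion d α r) :=
  (isOpen_lt ((continuous_profile hα).comp continuous_horiz.norm) continuous_vert).inter
    (isOpen_lt continuous_vert continuous_const)

theorem IsPowerDomain.mem_iff (hΩ : IsPowerDomain α η Ω) {x : Euc (d + 1)} (hx : vert x < η) :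
    x ∈ Ω ↔ profile α ‖horiz x‖ < vert x := by
  have := Set.ext_iff.1 hΩ.below x
  simpa [hx] using this

theorem IsPowerDomain.testRegion_subset (hΩ : IsPowerDomain α η Ω) (hr : profile α r < η) :
    testRegion d α r ⊆ Ω := fun _ hx => (hΩ.mem_iff (hx.2.trans hr)).2 hx.1

theorem continuous_fderiv_coord {n : ℕ} {φ : Euc n → Euc n} (h : ContDiff ℝ 1 φ) (v : Euc n)
    (i : Fin n) : Continuous fun x => (fderiv ℝ φ x v) i := by
  have := (h.continuous_fderiv one_ne_zero).clm_apply (continuous_const (y := v))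
  fun_prop

theorem integrable_fderiv_coord {n : ℕ} {φ : Euc n → Euc n} (h : ContDiff ℝ 1 φ)
    (hc : HasCompactSupport φ) (v : Euc n) (i : Fin n) :
    Integrable fun x => (fderiv ℝ φ x v) i := by
  refine (continuous_fderiv_coord h v i).integrable_of_hasCompactSupport ?_
  exact (hc.fderiv (𝕜 := ℝ)).comp_left (g := fun A : Euc n →L[ℝ] Euc n => (A v) i) (by simp)

theorem hasDerivAt_coord_line {n : ℕ} {φ : Euc n → Euc n} (h : ContDiff ℝ 1 φ) (x v : Euc n)
    (i : Fin n) (t : ℝ) :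
    HasDerivAt (fun s : ℝ => φ (x + s • v) i) ((fderiv ℝ φ (x + t • v) v) i) t := by
  have h1 : HasDerivAt (fun s : ℝ => x + s • v) v t := by
    simpa using ((hasDerivAt_id t).smul_const v).const_add x
  have h2 := (h.differentiable one_ne_zero (x + t • v)).hasFDerivAt.comp_hasDerivAt t h1
  exact (EuclideanSpace.proj (𝕜 := ℝ) i).hasFDerivAt.comp_hasDerivAt t h2

/-- The horizontal partial derivatives of a test field have integral zero over the test region. -/
theorem IsPowerDomain.integral_horizontal (hΩ : IsPowerDomain α η Ω) (hα : 0 < α)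
    (hr : profile α r < η) {φ : Euc (d + 1) → Euc (d + 1)} (hφ : IsTestField Ω φ) (i : Fin d) :
    ∫ x, (testRegion d α r).indicator
      (fun x => (fderiv ℝ φ x (EuclideanSpace.single i.castSucc 1)) i.castSucc) x = 0 := by
  obtain ⟨hd, hc, hs, -⟩ := hφ
  set v : Euc (d + 1) := EuclideanSpace.single i.castSucc 1 with hv
  set E := testRegion d α r with hE
  have hEm : MeasurableSet E := (isOpen_testRegion hα).measurableSet
  set D : Euc (d + 1) → ℝ := fun x => (fderiv ℝ φ x v) i.castSucc with hD
  set g : Euc (d + 1) → ℝ := E.indicator fun x => φ x i.castSucc with hg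
  have hvv : vert v = 0 := by simp [vert, hv]
  have hgi : Integrable g := by
    refine Integrable.indicator ?_ hEm
    refine Continuous.integrable_of_hasCompactSupport ?_ ?_
    · have := hd.continuous
      fun_prop
    · exact hc.comp_left (g := fun y : Euc (d + 1) => y i.castSucc) rfl
  have hDi : Integrable (E.indicator D) := (integrable_fderiv_coord hd hc _ _).indicator hEm
  -- The jump of χ_E is invisible along horizontal lines: below the lid, a point of the support of φ
  -- lies in Ω and hence in the open set E, while φ vanishes near every other point. At or above the
  -- lid's height, a horizontal line never meets E.
  have hline : ∀ x, HasLineDerivAt ℝ g (E.indicator D x) x v := by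
    intro x
    rw [HasLineDerivAt]
    have hcont : ContinuousAt (fun t : ℝ => x + t • v) 0 := by fun_prop
    have hcont' : Tendsto (fun t : ℝ => x + t • v) (𝓝 0) (𝓝 x) := by simpa using hcont.tendsto
    have hφx : HasDerivAt (fun s : ℝ => φ (x + s • v) i.castSucc) (D x) 0 := by
      simpa using hasDerivAt_coord_line hd x v i.castSucc 0
    by_cases hx : vert x < profile α r
    · by_cases hxs : x ∈ tsupport φ
      · have hxE : x ∈ E := ⟨(hΩ.mem_iff (hx.trans hr)).1 (hs hxs), hx⟩
        rw [indicator_of_mem hxE]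
        refine hφx.congr_of_eventuallyEq ?_
        filter_upwards [hcont' ((isOpen_testRegion hα).mem_nhds hxE)] with t ht
        exact indicator_of_mem (mem_preimage.1 ht) fun x => φ x i.castSucc
      · have h0 : E.indicator D x = 0 := by
          have : fderiv ℝ φ x = 0 :=
            Function.notMem_support.1 fun h => hxs (support_fderiv_subset ℝ (f := φ) h)
          simp [indicator, hD, this]
        rw [h0]
        refine (hasDerivAt_const (0 : ℝ) (0 : ℝ)).congr_of_eventuallyEq ?_
        filter_upwards [hcont' ((isClosed_tsupport φ).isOpen_compl.mem_nhds hxs)] with t ht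
        have : φ (x + t • v) = 0 := image_eq_zero_of_notMem_tsupport ht
        simp [hg, indicator, this]
    · have hout : ∀ t : ℝ, x + t • v ∉ E := fun t ht => hx (by
        have := ht.2
        rwa [vert_add, vert_smul, hvv, mul_zero, add_zero] at this)
      have hx0 : x ∉ E := by simpa using hout 0
      rw [indicator_of_notMem hx0]
      refine (hasDerivAt_const (0 : ℝ) (0 : ℝ)).congr_of_eventuallyEq (Eventually.of_forall fun t => ?_)
      exact indicator_of_notMem (hout t) fun x => φ x i.castSucc
  -- Integration by parts against the constant function 1.
  have := integral_bilinear_hasLineDerivAt_right_eq_neg_left_of_integrable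
    (μ := (volume : Measure (Euc (d + 1)))) (f := fun _ => (1 : ℝ)) (f' := fun _ => 0) (g := g)
    (g' := E.indicator D) (v := v) (B := ContinuousLinearMap.mul ℝ ℝ)
    (by simp) (by simpa using hDi) (by simpa using hgi)
    (fun x _ => hasDerivAt_const _ _) (fun x _ => hline x)
  simpa using this

theorem mkPoint_eq_add_smul (z : Euc d) (t : ℝ) :
    mkPoint z t = mkPoint z 0 + t • EuclideanSpace.single (Fin.last d) (1 : ℝ) := by
  have h : (EuclideanSpace.single (Fin.last d) (1 : ℝ) : Euc (d + 1)) = mkPoint 0 1 := by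
    apply (splitL d).injective
    rw [splitL_mkPoint, splitL_apply]
    refine Prod.ext ?_ (by simp [vert])
    ext i
    simp [horiz]
  apply (splitL d).injective
  rw [map_add, map_smul, h]
  simp

/-- The vertical partial derivative of a test field integrates to the flux through the flat top of
the test region. -/
theorem IsPowerDomain.integral_vertical (hΩ : IsPowerDomain α η Ω) (hα : 0 < α) (hr0 : 0 ≤ r)
    (hr : profile α r < η) {φ : Euc (d + 1) → Euc (d + 1)} (hφ : IsTestField Ω φ) :
    ∫ x, (testRegion d α r).indicator
      (fun x => (fderiv ℝ φ x (EuclideanSpace.single (Fin.last d) 1)) (Fin.last d)) x =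
    ∫ z in ball (0 : Euc d) r, vert (φ (mkPoint z (profile α r))) := by
  obtain ⟨hd, hc, hs, -⟩ := hφ
  set v : Euc (d + 1) := EuclideanSpace.single (Fin.last d) 1 with hv
  set E := testRegion d α r with hE
  have hEm : MeasurableSet E := (isOpen_testRegion hα).measurableSet
  set D : Euc (d + 1) → ℝ := fun x => (fderiv ℝ φ x v) (Fin.last d) with hD
  have hDi : Integrable (E.indicator D) := (integrable_fderiv_coord hd hc _ _).indicator hEm
  have hDc : Continuous D := continuous_fderiv_coord hd v (Fin.last d)
  rw [integral_eq_integral_mkPoint, Measure.volume_eq_prod,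
    integral_prod _ (integrable_mkPoint hDi), ← integral_indicator measurableSet_ball]
  congr 1
  ext z
  have hin : (fun t : ℝ => E.indicator D (mkPoint z t)) =
      (Ioo (profile α ‖z‖) (profile α r)).indicator fun t => D (mkPoint z t) := by
    ext t
    by_cases ht : t ∈ Ioo (profile α ‖z‖) (profile α r)
    · rw [indicator_of_mem ht, indicator_of_mem]
      simpa [hE, testRegion] using ht
    · rw [indicator_of_notMem ht, indicator_of_notMem]
      simpa [hE, testRegion] using ht
  simp only [hin]
  rw [integral_indicator measurableSet_Ioo, ← integral_Ioc_eq_integral_Ioo]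
  by_cases hz : ‖z‖ < r
  · have hlt := (profile_lt_profile hα (norm_nonneg z) hr0).2 hz
    rw [indicator_of_mem (by simpa using hz), ← intervalIntegral.integral_of_le hlt.le]
    have hder : ∀ t : ℝ, HasDerivAt (fun t => vert (φ (mkPoint z t))) (D (mkPoint z t)) t := by
      intro t
      have := hasDerivAt_coord_line hd (mkPoint z 0) v (Fin.last d) t
      simp only [hv, ← mkPoint_eq_add_smul] at this
      exact this
    rw [intervalIntegral.integral_eq_sub_of_hasDerivAt (fun t _ => hder t)
      ((hDc.comp (continuous_const.mkPoint continuous_id)).intervalIntegrable _ _)]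
    -- The lower end of the vertical segment is on the graph, hence outside Ω, so only the value at
    -- the lid survives.
    have hout : φ (mkPoint z (profile α ‖z‖)) = 0 := by
      refine image_eq_zero_of_notMem_tsupport fun h => ?_
      have h1 := (hΩ.mem_iff (by simpa using hlt.trans hr)).1 (hs h)
      simp at h1
    rw [hout, vert_zero, sub_zero]
  · rw [indicator_of_notMem (by simpa using hz), Ioc_eq_empty, Measure.restrict_empty,
      integral_zero_measure]
    rw [profile_lt_profile hα (norm_nonneg z) hr0]
    exact hz

/-- The divergence theorem for test fields on the test region. -/
theorem IsPowerDomain.integral_testFun_mul_divergence (hΩ : IsPowerDomain α η Ω) (hα : 0 < α)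
    (hr0 : 0 ≤ r) (hr : profile α r < η) {φ : Euc (d + 1) → Euc (d + 1)} (hφ : IsTestField Ω φ) :
    ∫ x in Ω, testFun d α r x * divergence φ x =
      ∫ z in ball (0 : Euc d) r, vert (φ (mkPoint z (profile α r))) := by
  have hEm : MeasurableSet (testRegion d α r) := (isOpen_testRegion hα).measurableSet
  have h1 : ∫ x in Ω, testFun d α r x * divergence φ x =
      ∫ x, ∑ i : Fin (d + 1), (testRegion d α r).indicator
        (fun x => (fderiv ℝ φ x (EuclideanSpace.single i 1)) i) x := by
    rw [← integral_indicator hΩ.domain.isOpen.measurableSet]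
    congr 1
    ext x
    by_cases hx : x ∈ testRegion d α r
    · simp [testFun, divergence, hx, hΩ.testRegion_subset hr hx]
    · simp [testFun, hx, indicator]
  have hi : ∀ i ∈ Finset.univ, Integrable ((testRegion d α r).indicator
      fun x => (fderiv ℝ φ x (EuclideanSpace.single i 1)) i) := fun i _ =>
    (integrable_fderiv_coord hφ.1 hφ.2.1 _ _).indicator hEm
  rw [h1, integral_finsetSum _ hi, Fin.sum_univ_castSucc,
    hΩ.integral_vertical hα hr0 hr hφ]
  simp only [hΩ.integral_horizontal hα hr hφ, Finset.sum_const_zero, zero_add]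

/-- The flux of a field of length at most 1 through the lid is at most the area of the lid. -/
theorem IsPowerDomain.totalVariation_le (hd : 1 ≤ d) (hΩ : IsPowerDomain α η Ω) (hα : 0 < α) (hr0 : 0 ≤ r)
    (hr : profile α r < η) :
    totalVariation Ω (testFun d α r) ≤ ENNReal.ofReal (unitBallVolume d * r ^ d) := by
  refine iSup₂_le fun φ hφ => ENNReal.ofReal_le_ofReal ?_
  rw [hΩ.integral_testFun_mul_divergence hα hr0 hr hφ, ← volume_real_ball hd hr0]
  refine (Real.le_norm_self _).trans ?_
  refine (norm_setIntegral_le_of_norm_le_const (C := 1) measure_ball_lt_top fun z _ => ?_).trans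
    (by rw [one_mul])
  exact (abs_vert_le _).trans (hφ.2.2.2 _)

theorem exists_contDiff_cutoff {n : ℕ} {K U : Set (Euc n)} (hK : IsCompact K) (hU : IsOpen U)
    (hKU : K ⊆ U) : ∃ θ : Euc n → ℝ, ContDiff ℝ 1 θ ∧ HasCompactSupport θ ∧ tsupport θ ⊆ U ∧
      (∀ x ∈ K, θ x = 1) ∧ ∀ x, θ x ∈ Icc (0 : ℝ) 1 := by
  obtain ⟨L, hL, hKL, hLU⟩ := exists_compact_between hK hU hKU
  obtain ⟨f, h1, h0, hf⟩ := exists_contMDiffMap_one_nhds_of_subset_interior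
    (modelWithCornersSelf ℝ (Euc n)) (n := 1) hK.isClosed hKL
  have hts : tsupport f ⊆ L := closure_minimal (fun x hx => by
    by_contra h
    exact hx (h0 x h)) hL.isClosed
  exact ⟨f, f.contMDiff.contDiff, HasCompactSupport.intro hL h0, hts.trans hLU,
    fun x hx => h1.self_of_nhdsSet x hx, hf⟩

/-- A vertical field cut off to equal the upward unit vector on the smaller disc has at least the
area of that disc as its flux. The radius must be less than r because the rim of the full lid lies
on ∂Ω, so the closed lid is not contained in Ω. -/
theorem IsPowerDomain.le_totalVariation (hd : 1 ≤ d) (hΩ : IsPowerDomain α η Ω) (hα : 0 < α)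
    (hr : profile α r < η) {s : ℝ} (hs0 : 0 ≤ s) (hsr : s < r) :
    ENNReal.ofReal (unitBallVolume d * s ^ d) ≤ totalVariation Ω (testFun d α r) := by
  have hr0 : 0 ≤ r := hs0.trans hsr.le
  set K : Set (Euc (d + 1)) := (fun z => mkPoint z (profile α r)) '' closedBall 0 s with hKdef
  have hK : IsCompact K := (isCompact_closedBall 0 s).image (continuous_id.mkPoint continuous_const)
  have hKΩ : K ⊆ Ω := by
    rintro _ ⟨z, hz, rfl⟩
    refine (hΩ.mem_iff (by simpa using hr)).2 ?_
    simp only [horiz_mkPoint, vert_mkPoint]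
    refine (profile_lt_profile hα (norm_nonneg z) hr0).2 ?_
    rw [mem_closedBall_zero_iff] at hz
    linarith
  obtain ⟨θ, hθd, hθc, hθΩ, hθ1, hθ⟩ := exists_contDiff_cutoff hK hΩ.domain.isOpen hKΩ
  set e : Euc (d + 1) := EuclideanSpace.single (Fin.last d) 1 with he
  have hve : vert e = 1 := by simp [vert, he]
  have hφ : IsTestField Ω fun x => θ x • e := by
    refine ⟨hθd.smul contDiff_const, hθc.smul_right, ?_, fun x => ?_⟩
    · exact (closure_mono (Function.support_smul_subset_left θ fun _ => e)).trans hθΩ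
    · rw [norm_smul, show ‖e‖ = 1 by simp [he], mul_one, Real.norm_of_nonneg (hθ x).1]
      exact (hθ x).2
  refine le_trans (ENNReal.ofReal_le_ofReal ?_) (le_iSup₂_of_le _ hφ le_rfl)
  rw [hΩ.integral_testFun_mul_divergence hα hr0 hr hφ, ← volume_real_ball hd hs0]
  simp only [vert_smul, hve, mul_one]
  have hcont : Continuous fun z : Euc d => θ (mkPoint z (profile α r)) :=
    hθd.continuous.comp (continuous_id.mkPoint continuous_const)
  have hint : IntegrableOn (fun z : Euc d => θ (mkPoint z (profile α r))) (ball 0 r) :=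
    (hcont.continuousOn.integrableOn_compact (isCompact_closedBall 0 r)).mono_set
      ball_subset_closedBall
  calc volume.real (ball (0 : Euc d) s) = ∫ z in ball (0 : Euc d) s, (1 : ℝ) := by simp
    _ = ∫ z in ball (0 : Euc d) s, θ (mkPoint z (profile α r)) :=
        setIntegral_congr_fun measurableSet_ball fun z hz =>
          (hθ1 _ ⟨z, ball_subset_closedBall hz, rfl⟩).symm
    _ ≤ _ := setIntegral_mono_set hint (ae_of_all _ fun z => (hθ _).1)
        (ball_subset_ball hsr.le).eventuallyLE

/-- The total variation of the characteristic function of the test region is the area of its flat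
top. -/
theorem IsPowerDomain.totalVariation_testFun (hd : 1 ≤ d) (hΩ : IsPowerDomain α η Ω) (hα : 0 < α)
    (hr0 : 0 < r) (hr : profile α r < η) :
    totalVariation Ω (testFun d α r) = ENNReal.ofReal (unitBallVolume d * r ^ d) := by
  refine le_antisymm (hΩ.totalVariation_le hd hα hr0.le hr) ?_
  have hlim : Tendsto (fun s : ℝ => ENNReal.ofReal (unitBallVolume d * s ^ d)) (𝓝[<] r)
      (𝓝 (ENNReal.ofReal (unitBallVolume d * r ^ d))) :=
    (ENNReal.continuous_ofReal.comp (by fun_prop : Continuous fun s : ℝ =>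
      unitBallVolume d * s ^ d)).continuousAt.tendsto.mono_left nhdsWithin_le_nhds
  refine le_of_tendsto hlim ?_
  filter_upwards [Ioo_mem_nhdsLT hr0] with s hs
  exact hΩ.le_totalVariation hd hα hr hs.1.le hs.2

end TestRegion

/-! ### Volume, trace and boundary integral of the test function -/

theorem hasTraceAt_of_eventually_eq {n : ℕ} {Ω : Set (Euc n)} {u : Euc n → ℝ} {x : Euc n} {c : ℝ}
    (h : ∀ᶠ y in 𝓝 x, y ∈ Ω → u y = c) : HasTraceAt Ω u x c := by
  obtain ⟨δ, hδ, hball⟩ := Metric.eventually_nhds_iff_ball.1 h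
  refine tendsto_const_nhds.congr' ?_
  filter_upwards [Ioo_mem_nhdsGT hδ] with ρ hρ
  rw [setAverage_eq, setIntegral_eq_zero_of_forall_eq_zero, smul_zero]
  rintro y ⟨hy, hyΩ⟩
  rw [hball y (ball_subset_ball hρ.2.le hy) hyΩ, sub_self, abs_zero]

/-- Uniqueness of the trace makes the choice in `bvTrace` harmless. -/
theorem bvTrace_eq {n : ℕ} {Ω : Set (Euc n)} {u : Euc n → ℝ} {x : Euc n} {c : ℝ}
    (hΩ : IsOpen Ω) (hu : IntegrableOn u Ω volume) (hx : x ∈ closure Ω) (h : HasTraceAt Ω u x c) :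
    bvTrace Ω u x = c := by
  have hex : ∃ c : ℝ, HasTraceAt Ω u x c := ⟨c, h⟩
  rw [bvTrace, dif_pos hex]
  exact HasTraceAt.unique hΩ hu hx hex.choose_spec h

section TestRegion

variable {d : ℕ} {α η r : ℝ} {Ω : Set (Euc (d + 1))}

theorem volume_testRegion_lt_top (hα : 0 < α) (hr0 : 0 ≤ r) : volume (testRegion d α r) < ⊤ := by
  refine (measure_mono (fun x hx => ?_)).trans_lt
    (measure_closedBall_lt_top (x := (0 : Euc (d + 1))) (r := r + profile α r))
  rw [mem_closedBall_zero_iff]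
  have h1 := (profile_lt_profile hα (norm_nonneg _) hr0).1 (hx.1.trans hx.2)
  have h2 := profile_nonneg hα ‖horiz x‖
  have h3 : |vert x| = vert x := abs_of_nonneg (h2.trans hx.1.le)
  linarith [norm_le_horiz_add_vert x, hx.2]

theorem integrable_testFun (hα : 0 < α) (hr0 : 0 ≤ r) : Integrable (testFun d α r) :=
  (integrable_indicator_iff (isOpen_testRegion hα).measurableSet).2
    (integrableOn_const (volume_testRegion_lt_top hα hr0).ne)

theorem IsPowerDomain.memBV_testFun (hd : 1 ≤ d) (hΩ : IsPowerDomain α η Ω) (hα : 0 < α)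
    (hr0 : 0 < r) (hr : profile α r < η) : MemBV Ω (testFun d α r) := by
  refine ⟨(integrable_testFun hα hr0.le).integrableOn, ?_⟩
  rw [hΩ.totalVariation_testFun hd hα hr0 hr]
  exact ENNReal.ofReal_lt_top

theorem IsPowerDomain.integral_abs_testFun (hd : 1 ≤ d) (hΩ : IsPowerDomain α η Ω) (hα : 0 < α)
    (hr0 : 0 < r) (hr : profile α r < η) :
    ∫ x in Ω, |testFun d α r x| =
      unitBallVolume d / ((d : ℝ) + 1 + α) * r ^ ((d : ℝ) + 1 + α) := by
  have h1 : ∫ x in Ω, |testFun d α r x| = ∫ x, testFun d α r x := by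
    rw [← integral_indicator hΩ.domain.isOpen.measurableSet]
    congr 1
    ext x
    by_cases hx : x ∈ testRegion d α r
    · simp [testFun, hx, hΩ.testRegion_subset hr hx]
    · simp [testFun, hx, indicator]
  -- The region has height ψ(r) - ψ(|z|) above z. After radial integration the constants combine as
  -- (1 - d/(d+1+α))/(1+α) = 1/(d+1+α).
  have h2 : ∀ z : Euc d, ∫ t, testFun d α r (mkPoint z t) =
      (ball (0 : Euc d) r).indicator (fun z => profile α r - profile α ‖z‖) z := by
    intro z
    have hin : (fun t : ℝ => testFun d α r (mkPoint z t)) =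
        (Ioo (profile α ‖z‖) (profile α r)).indicator fun _ => 1 := by
      ext t
      simp [testFun, testRegion, indicator]
    rw [hin, integral_indicator measurableSet_Ioo, setIntegral_const, smul_eq_mul, mul_one]
    by_cases hz : ‖z‖ < r
    · have := (profile_lt_profile hα (norm_nonneg z) hr0.le).2 hz
      rw [indicator_of_mem (by simpa using hz), Real.volume_real_Ioo_of_le this.le]
    · have : ¬ profile α ‖z‖ < profile α r := by
        rwa [profile_lt_profile hα (norm_nonneg z) hr0.le]
      rw [indicator_of_notMem (by simpa using hz), Ioo_eq_empty this, measureReal_empty]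
  have hint : IntegrableOn (fun z : Euc d => ‖z‖ ^ (1 + α) / (1 + α)) (ball 0 r) :=
    (integrableOn_ball_norm_rpow (by positivity) r).div_const _
  rw [h1, integral_eq_integral_mkPoint, Measure.volume_eq_prod,
    integral_prod _ (integrable_mkPoint (integrable_testFun hα hr0.le))]
  simp only [h2]
  rw [integral_indicator measurableSet_ball]
  simp only [profile_norm]
  have hconst : IntegrableOn (fun _ : Euc d => profile α r) (ball 0 r) :=
    integrableOn_const measure_ball_lt_top.ne
  rw [integral_sub hconst hint, setIntegral_const,
    integral_div, integral_ball_norm_rpow hd (by positivity) hr0.le, volume_real_ball hd hr0.le,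
    profile, abs_of_pos hr0, smul_eq_mul, ← Real.rpow_natCast r d,
    add_assoc (d : ℝ) 1 α, Real.rpow_add hr0 (d : ℝ) (1 + α)]
  have : (0 : ℝ) ≤ d := Nat.cast_nonneg d
  field_simp
  ring

/-- Above the graph a point is interior to Ω; strictly below it, a whole neighbourhood misses Ω. -/
theorem IsPowerDomain.vert_eq_of_mem_frontier (hΩ : IsPowerDomain α η Ω) (hα : 0 < α)
    {x : Euc (d + 1)} (hx : x ∈ frontier Ω) (hη : vert x < η) :
    vert x = profile α ‖horiz x‖ := by
  rw [hΩ.domain.isOpen.frontier_eq] at hx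
  refine le_antisymm (not_lt.1 fun h => hx.2 ((hΩ.mem_iff hη).2 h)) (not_lt.1 fun h => ?_)
  have hopen : IsOpen ({y : Euc (d + 1) | vert y < η} ∩ {y | vert y < profile α ‖horiz y‖}) :=
    (isOpen_lt continuous_vert continuous_const).inter
      (isOpen_lt continuous_vert ((continuous_profile hα).comp continuous_horiz.norm))
  obtain ⟨y, hy, hyΩ⟩ := mem_closure_iff.1 hx.1 _ hopen ⟨hη, h⟩
  exact lt_asymm ((hΩ.mem_iff hy.1).1 hyΩ) hy.2

theorem IsPowerDomain.mkPoint_mem_frontier (hΩ : IsPowerDomain α η Ω)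
    {z : Euc d} (hz : profile α ‖z‖ < η) : mkPoint z (profile α ‖z‖) ∈ frontier Ω := by
  rw [hΩ.domain.isOpen.frontier_eq]
  refine ⟨?_, fun h => ?_⟩
  · have hlim : Tendsto (fun t : ℝ => mkPoint z t) (𝓝[>] (profile α ‖z‖))
        (𝓝 (mkPoint z (profile α ‖z‖))) :=
      (continuous_const.mkPoint continuous_id).continuousAt.tendsto.mono_left nhdsWithin_le_nhds
    refine mem_closure_of_tendsto hlim ?_
    filter_upwards [Ioo_mem_nhdsGT hz] with t ht
    exact (hΩ.mem_iff (by simpa using ht.2)).2 (by simpa using ht.1)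
  · have := (hΩ.mem_iff (by simpa using hz)).1 h
    simp at this

theorem IsPowerDomain.frontier_inter (hΩ : IsPowerDomain α η Ω) (hα : 0 < α) (hr0 : 0 ≤ r)
    (hr : profile α r < η) :
    frontier Ω ∩ {x | vert x < profile α r} =
      (fun z => mkPoint z (profile α ‖z‖)) '' ball (0 : Euc d) r := by
  ext x
  constructor
  · rintro ⟨hx, hxr⟩
    have h := hΩ.vert_eq_of_mem_frontier hα hx (lt_trans hxr hr)
    refine ⟨horiz x, ?_, ?_⟩
    · rw [mem_ball_zero_iff, ← profile_lt_profile hα (norm_nonneg _) hr0, ← h]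
      exact hxr
    · simp only
      rw [← h, mkPoint_horiz_vert]
  · rintro ⟨z, hz, rfl⟩
    rw [mem_ball_zero_iff] at hz
    have := (profile_lt_profile hα (norm_nonneg z) hr0).2 hz
    exact ⟨hΩ.mkPoint_mem_frontier (this.trans hr), by simpa using this⟩

theorem euclideanHausdorffMeasure_profile_graph (hα : 0 < α) {s : Set (Euc d)}
    (hs : MeasurableSet s) :
    Measure.euclideanHausdorffMeasure d ((fun z => mkPoint z (profile α ‖z‖)) '' s) =
      ∫⁻ z in s, ENNReal.ofReal (Real.sqrt (1 + ‖z‖ ^ (2 * α))) := by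
  rw [euclideanHausdorffMeasure_graph (contDiff_profile_norm hα) hs]
  simp only [norm_fderiv_profile_norm hα]
  refine lintegral_congr fun z => ?_
  rw [← Real.rpow_natCast, ← Real.rpow_mul (norm_nonneg z), Nat.cast_ofNat, mul_comm α]

/-- The trace of the test function exists off the rim of the graph, and is `1` below the flat top
and `0` elsewhere. -/
theorem IsPowerDomain.ae_hasTraceAt (hΩ : IsPowerDomain α η Ω) (hα : 0 < α) (hr0 : 0 < r)
    (hr : profile α r < η) :
    ∀ᵐ x ∂((Measure.euclideanHausdorffMeasure d).restrict (frontier Ω)),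
      HasTraceAt Ω (testFun d α r) x
        ({y : Euc (d + 1) | vert y < profile α r}.indicator (fun _ => (1 : ℝ)) x) := by
  rw [ae_restrict_iff' isClosed_frontier.measurableSet, ae_iff]
  -- The rim is the graph over a sphere, which is Lebesgue null, so the area formula gives it
  -- measure zero. At every other boundary point the test function is constant on Ω nearby.
  have hnull : Measure.euclideanHausdorffMeasure d
      ((fun z => mkPoint z (profile α ‖z‖)) '' sphere (0 : Euc d) r) = 0 := by
    rw [euclideanHausdorffMeasure_profile_graph hα isClosed_sphere.measurableSet]
    exact setLIntegral_measure_zero _ _ (Measure.addHaar_sphere_of_ne_zero _ _ hr0.ne')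
  refine measure_mono_null (fun x hx => ?_) hnull
  rw [mem_ofPred_eq, Classical.not_imp] at hx
  obtain ⟨hxf, hx⟩ := hx
  rcases lt_trichotomy (vert x) (profile α r) with h | h | h
  · refine absurd (hasTraceAt_of_eventually_eq ?_) hx
    filter_upwards [(isOpen_lt continuous_vert continuous_const).mem_nhds h] with y hy hyΩ
    rw [indicator_of_mem (by exact h), testFun, indicator_of_mem]
    exact ⟨(hΩ.mem_iff (lt_trans hy hr)).1 hyΩ, hy⟩
  · have hv := hΩ.vert_eq_of_mem_frontier hα hxf (h ▸ hr)
    refine ⟨horiz x, ?_, ?_⟩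
    · rw [mem_sphere_zero_iff_norm]
      rw [h] at hv
      exact le_antisymm ((profile_le_profile hα (norm_nonneg _) hr0.le).1 hv.ge)
        ((profile_le_profile hα hr0.le (norm_nonneg _)).1 hv.le)
    · simp only
      rw [← hv, mkPoint_horiz_vert]
  · refine absurd (hasTraceAt_of_eventually_eq ?_) hx
    filter_upwards [(isOpen_lt continuous_const continuous_vert).mem_nhds h] with y hy _
    rw [indicator_of_notMem (by exact not_lt.2 h.le), testFun, indicator_of_notMem]
    exact fun hyE => lt_asymm hyE.2 hy

theorem IsPowerDomain.boundaryIntegral_testFun (hΩ : IsPowerDomain α η Ω) (hα : 0 < α)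
    (hr0 : 0 < r) (hr : profile α r < η) :
    boundaryIntegral Ω (testFun d α r) =
      ∫ z in ball (0 : Euc d) r, Real.sqrt (1 + ‖z‖ ^ (2 * α)) := by
  have hm : MeasurableSet {y : Euc (d + 1) | vert y < profile α r} :=
    (isOpen_lt continuous_vert continuous_const).measurableSet
  have hae : ∀ᵐ x ∂((Measure.euclideanHausdorffMeasure d).restrict (frontier Ω)),
      |bvTrace Ω (testFun d α r) x| =
        {y : Euc (d + 1) | vert y < profile α r}.indicator (fun _ => (1 : ℝ)) x := by
    filter_upwards [hΩ.ae_hasTraceAt hα hr0 hr,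
      ae_restrict_mem isClosed_frontier.measurableSet] with x hx hxf
    rw [bvTrace_eq hΩ.domain.isOpen (integrable_testFun hα hr0.le).integrableOn
      (frontier_subset_closure hxf) hx, abs_of_nonneg]
    exact indicator_nonneg (fun _ _ => zero_le_one) _
  rw [boundaryIntegral, integral_congr_ae hae, integral_indicator hm, Measure.restrict_restrict hm,
    inter_comm, hΩ.frontier_inter hα hr0.le hr, setIntegral_const, smul_eq_mul, mul_one,
    measureReal_def, euclideanHausdorffMeasure_profile_graph hα measurableSet_ball,
    integral_eq_lintegral_of_nonneg_ae (ae_of_all _ fun z => Real.sqrt_nonneg _)]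
  refine Continuous.aestronglyMeasurable ?_
  exact (continuous_const.add
    (continuous_norm.rpow_const fun _ => Or.inr (by positivity))).sqrt

end TestRegion

/-! ### Recognizing C^{1,α} boundaries -/

theorem IsC1HolderOn.mono {d : ℕ} {α : ℝ} {f : Euc d → ℝ} {V W : Set (Euc d)}
    (h : IsC1HolderOn α f W) (hVW : V ⊆ W) : IsC1HolderOn α f V :=
  ⟨h.1.mono hVW, h.2.imp fun _ hK x hx y hy => hK x (hVW hx) y (hVW hy)⟩

/-- A `C^2` function is of class `C^{1,α}` near each point. -/
theorem exists_isC1HolderOn_of_contDiffAt {d : ℕ} {α : ℝ} (hα1 : α < 1)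
    {f : Euc d → ℝ} {y : Euc d} (hf : ContDiffAt ℝ 2 f y) :
    ∃ ρ : ℝ, 0 < ρ ∧ IsC1HolderOn α f (ball y ρ) := by
  have h1 : ∀ᶠ z in 𝓝 y, ContDiffAt ℝ 2 f z := hf.eventually (by simp)
  obtain ⟨K, t, ht, hK⟩ := (hf.fderiv_right (m := 1) (by norm_num)).exists_lipschitzOnWith
  obtain ⟨ρ, hρ, hball⟩ := Metric.eventually_nhds_iff_ball.1 (h1.and ht)
  -- Radius at most 1/2 keeps mutual distances at most 1, where t ≤ t^α and a Lipschitz bound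
  -- implies the Hölder bound.
  refine ⟨min ρ (1 / 2), by positivity, ?_, K, ?_⟩
  · intro z hz
    exact ((hball z (ball_subset_ball (min_le_left _ _) hz)).1.of_le (by norm_num)).contDiffWithinAt
  · intro x hx z hz
    have hxz : ‖x - z‖ ≤ 1 := by
      rw [← dist_eq_norm]
      have hx' : dist x y < 1 / 2 := (mem_ball.1 hx).trans_le (min_le_right _ _)
      have hz' : dist z y < 1 / 2 := (mem_ball.1 hz).trans_le (min_le_right _ _)
      linarith [dist_triangle_right x z y]
    have hl := hK.dist_le_mul x (hball x (ball_subset_ball (min_le_left _ _) hx)).2 z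
      (hball z (ball_subset_ball (min_le_left _ _) hz)).2
    rw [dist_eq_norm, dist_eq_norm] at hl
    refine hl.trans ?_
    gcongr
    exact Real.self_le_rpow_of_le_one (norm_nonneg _) hxz hα1.le

theorem exists_linearIsometryEquiv_apply_eq {n : ℕ} {v w : Euc n} (h : ‖v‖ = ‖w‖) :
    ∃ T : Euc n ≃ₗᵢ[ℝ] Euc n, T v = w :=
  ⟨_, Submodule.reflection_sub h⟩

/-- The sublevel set of a `C^2` function is locally the region above a `C^{1,α}` graph at each
point of the zero set where the derivative does not vanish. -/
theorem exists_graph_of_contDiffAt {d : ℕ} {α : ℝ} (hα1 : α < 1)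
    {F : Euc (d + 1) → ℝ} {p : Euc (d + 1)} (hF : ContDiffAt ℝ 2 F p) (h0 : F p = 0)
    (hne : fderiv ℝ F p ≠ 0) :
    ∃ ρ : ℝ, 0 < ρ ∧ ∃ (T : Euc (d + 1) ≃ₗᵢ[ℝ] Euc (d + 1)) (f : Euc d → ℝ),
      IsC1HolderOn α f (ball (horiz (T p)) ρ) ∧
      ∀ x ∈ ball p ρ, F x < 0 ↔ f (horiz (T x)) < vert (T x) := by
  -- The direction w is rotated to the vertical axis. Since F decreases along w, the set where F < 0
  -- lies above the zero set.
  obtain ⟨w, hw1, hw⟩ : ∃ w : Euc (d + 1), ‖w‖ = 1 ∧ fderiv ℝ F p w < 0 := by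
    obtain ⟨v, hv⟩ : ∃ v, fderiv ℝ F p v ≠ 0 := by
      by_contra! h
      exact hne (ContinuousLinearMap.ext h)
    have hv0 : 0 < ‖v‖ := norm_pos_iff.2 fun h => hv (by rw [h, map_zero])
    rcases lt_or_gt_of_ne hv with h | h
    · refine ⟨‖v‖⁻¹ • v, by simp [norm_smul, hv0.ne'], ?_⟩
      rw [map_smul, smul_eq_mul]
      exact mul_neg_of_pos_of_neg (by positivity) h
    · refine ⟨-(‖v‖⁻¹ • v), by simp [norm_smul, hv0.ne'], ?_⟩
      rw [map_neg, map_smul, smul_eq_mul]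
      exact neg_neg_of_pos (mul_pos (by positivity) h)
  have he : ‖(mkPoint 0 1 : Euc (d + 1))‖ = 1 := by
    have := norm_sq_eq_horiz_vert (mkPoint 0 1 : Euc (d + 1))
    rw [horiz_mkPoint, vert_mkPoint, norm_zero] at this
    nlinarith [norm_nonneg (mkPoint 0 1 : Euc (d + 1))]
  obtain ⟨T, hT⟩ := exists_linearIsometryEquiv_apply_eq (hw1.trans he.symm)
  set S : (Euc d × ℝ) ≃L[ℝ] Euc (d + 1) :=
    (splitL d).symm.trans T.symm.toContinuousLinearEquiv with hS
  have hSs : ∀ x, S.symm x = (horiz (T x), vert (T x)) := fun x => rfl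
  have hS01 : S (0, 1) = w := by
    rw [← T.symm_apply_apply w, hT]
    rfl
  set u : Euc d × ℝ := S.symm p with hu
  have hSu : S u = p := S.apply_symm_apply p
  set H : Euc d × ℝ → ℝ := F ∘ S with hH
  have hHd : ContDiffAt ℝ 2 H u := by
    refine ContDiffAt.comp u ?_ S.contDiff.contDiffAt
    rwa [hSu]
  have hH' : fderiv ℝ H u (0, 1) < 0 := by
    rw [hH, S.comp_right_fderiv, hSu]
    simpa [hS01] using hw
  have hinv : (fderiv ℝ H u ∘L .inr ℝ (Euc d) ℝ).IsInvertible := by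
    refine ⟨ContinuousLinearEquiv.unitsEquivAut ℝ (Units.mk0 _ hH'.ne), ?_⟩
    ext
    simp
  have h20 : (2 : WithTop ℕ∞) ≠ 0 := by norm_num
  set f := hHd.implicitFunction h20 hinv with hf
  have hfu : f u.1 = u.2 := hHd.implicitFunction_apply_self h20 hinv
  have hHu : H u = 0 := by rw [hH, Function.comp_apply, hSu, h0]
  have hfd : ContDiffAt ℝ 2 f u.1 := hHd.contDiffAt_implicitFunction h20 hinv
  obtain ⟨ρ₁, hρ₁, hfH⟩ := exists_isC1HolderOn_of_contDiffAt hα1 hfd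
  have hev : ∀ᶠ v in 𝓝 u, DifferentiableAt ℝ H v ∧ fderiv ℝ H v (0, 1) < 0 := by
    refine ((hHd.eventually (by simp)).mono fun v hv => hv.differentiableAt h20).and ?_
    have hc : ContinuousAt (fun v => fderiv ℝ H v (0, 1)) u :=
      ((hHd.fderiv_right (m := 1) (by norm_num)).continuousAt).clm_apply continuousAt_const
    exact hc.eventually (gt_mem_nhds hH')
  obtain ⟨δ, hδ, hball⟩ := Metric.eventually_nhds_iff_ball.1 hev
  have hev2 : ∀ᶠ y in 𝓝 u.1, H (y, f y) = 0 ∧ f y ∈ ball u.2 δ := by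
    have hfc := hfd.continuousAt
    rw [ContinuousAt, hfu] at hfc
    have := hHd.eventually_apply_implicitFunction h20 hinv
    rw [hHu] at this
    exact this.and (hfc.eventually (ball_mem_nhds _ hδ))
  obtain ⟨ρ₂, hρ₂, hball2⟩ := Metric.eventually_nhds_iff_ball.1 hev2
  refine ⟨min δ (min ρ₁ ρ₂), by positivity, T, f, hfH.mono (ball_subset_ball ?_), fun x hx => ?_⟩
  · exact (min_le_right _ _).trans (min_le_left _ _)
  have hdist : dist (T x) (T p) < min δ (min ρ₁ ρ₂) := by rwa [T.dist_map, ← mem_ball]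
  rw [dist_eq_norm] at hdist
  set y := horiz (T x) with hy
  set t := vert (T x) with ht
  have hyu : dist y u.1 < min δ (min ρ₁ ρ₂) := by
    rw [dist_eq_norm]
    exact (norm_horiz_le (T x - T p)).trans_lt hdist
  have htu : dist t u.2 < min δ (min ρ₁ ρ₂) := by
    rw [Real.dist_eq]
    exact (abs_vert_le (T x - T p)).trans_lt hdist
  have hyδ : y ∈ ball u.1 δ := hyu.trans_le (min_le_left _ _)
  have htδ : t ∈ ball u.2 δ := htu.trans_le (min_le_left _ _)
  obtain ⟨hHf, hfδ⟩ := hball2 y (hyu.trans_le ((min_le_right _ _).trans (min_le_right _ _)))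
  have hder : ∀ s ∈ ball u.2 δ, HasDerivAt (fun s => H (y, s)) (fderiv ℝ H (y, s) (0, 1)) s := by
    intro s hs
    have hm : (y, s) ∈ ball u δ := by
      rw [← ball_prod_same]
      exact ⟨hyδ, hs⟩
    exact (hball _ hm).1.hasFDerivAt.comp_hasDerivAt s
      ((hasDerivAt_const s y).prodMk (hasDerivAt_id s))
  -- Strict decrease along the vertical segment, with the zero at height f(y), makes F < 0
  -- equivalent to lying above f(y).
  have hanti : StrictAntiOn (fun s => H (y, s)) (ball u.2 δ) := by
    refine strictAntiOn_of_deriv_neg (convex_ball _ _)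
      (fun s hs => (hder s hs).continuousAt.continuousWithinAt) fun s hs => ?_
    have hs' := interior_subset hs
    have hm : (y, s) ∈ ball u δ := by
      rw [← ball_prod_same]
      exact ⟨hyδ, hs'⟩
    rw [(hder s hs').deriv]
    exact (hball _ hm).2
  have hFx : F x = H (y, t) := by
    rw [hH, Function.comp_apply, ← hSs x, S.apply_symm_apply]
  rw [hFx, ← hHf]
  exact hanti.lt_iff_gt htδ hfδ

/-- The vector field `z ↦ |z|^(α-1) z` is `α`-Hölder continuous. -/
theorem norm_rpow_smul_sub_le {E : Type*} [NormedAddCommGroup E] [NormedSpace ℝ E] {α : ℝ}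
    (hα0 : 0 < α) (hα1 : α < 1) (z w : E) :
    ‖‖z‖ ^ (α - 1) • z - ‖w‖ ^ (α - 1) • w‖ ≤ 2 * ‖z - w‖ ^ α := by
  wlog hzw : ‖w‖ ≤ ‖z‖ generalizing z w
  · rw [norm_sub_rev, norm_sub_rev z]
    exact this w z (le_of_not_ge hzw)
  have hnorm : ∀ v : E, ‖‖v‖ ^ (α - 1) • v‖ = ‖v‖ ^ α := fun v => by
    rw [norm_smul, Real.norm_of_nonneg (by positivity), ← Real.rpow_add_one' (norm_nonneg v)
      (by linarith), sub_add_cancel]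
  -- If |z - w| is at least the larger norm |z|, the triangle inequality suffices. Otherwise the
  -- difference splits into |z|^(α-1)(z - w) and a change of the scalar factor; each is at most
  -- |z|^(α-1)|z - w|, which is at most |z - w|^α because α - 1 < 0.
  rcases le_or_gt ‖z‖ ‖z - w‖ with h | h
  · refine (norm_sub_le _ _).trans ?_
    rw [hnorm, hnorm, two_mul]
    gcongr
    exact hzw.trans h
  · have hz : 0 < ‖z‖ := (norm_nonneg _).trans_lt h
    have h1 : ‖‖z‖ ^ (α - 1) • (z - w)‖ = ‖z‖ ^ (α - 1) * ‖z - w‖ := by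
      rw [norm_smul, Real.norm_of_nonneg (by positivity)]
    have h2 : ‖(‖z‖ ^ (α - 1) - ‖w‖ ^ (α - 1)) • w‖ ≤ ‖z‖ ^ (α - 1) * ‖z - w‖ := by
      rcases eq_or_ne w 0 with rfl | hw
      · rw [smul_zero, norm_zero]
        positivity
      have hw0 : 0 < ‖w‖ := norm_pos_iff.2 hw
      have hle : ‖z‖ ^ (α - 1) ≤ ‖w‖ ^ (α - 1) :=
        Real.rpow_le_rpow_of_nonpos hw0 hzw (by linarith)
      -- Monotonicity of t^α bounds (|w|^(α-1) - |z|^(α-1))|w| by |z|^(α-1)(|z| - |w|).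
      have hpow : ‖w‖ ^ (α - 1) * ‖w‖ ≤ ‖z‖ ^ (α - 1) * ‖z‖ := by
        rw [← Real.rpow_add_one hw0.ne', ← Real.rpow_add_one hz.ne', sub_add_cancel]
        gcongr
      rw [norm_smul, Real.norm_eq_abs, abs_of_nonpos (by linarith)]
      have h3 : ‖z‖ - ‖w‖ ≤ ‖z - w‖ := norm_sub_norm_le z w
      have h4 := mul_le_mul_of_nonneg_left h3 (Real.rpow_nonneg hz.le (α - 1))
      linarith
    have h5 : ‖z‖ ^ (α - 1) * ‖z - w‖ ≤ ‖z - w‖ ^ α := by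
      rcases (norm_nonneg (z - w)).eq_or_lt with h0 | h0
      · rw [← h0, mul_zero]
        exact Real.rpow_nonneg le_rfl _
      · calc ‖z‖ ^ (α - 1) * ‖z - w‖ ≤ ‖z - w‖ ^ (α - 1) * ‖z - w‖ := by
              gcongr ?_ * _
              exact Real.rpow_le_rpow_of_nonpos h0 h.le (by linarith)
          _ = ‖z - w‖ ^ α := by rw [← Real.rpow_add_one h0.ne', sub_add_cancel]
    have h6 : ‖z‖ ^ (α - 1) • z - ‖w‖ ^ (α - 1) • w =
        ‖z‖ ^ (α - 1) • (z - w) + (‖z‖ ^ (α - 1) - ‖w‖ ^ (α - 1)) • w := by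
      rw [smul_sub, sub_smul]
      abel
    rw [h6]
    refine (norm_add_le _ _).trans ?_
    rw [h1]
    linarith

theorem isC1HolderOn_profile_norm {d : ℕ} {α : ℝ} (hα0 : 0 < α) (hα1 : α < 1) (c : ℝ)
    (W : Set (Euc d)) : IsC1HolderOn α (fun z => profile α ‖z‖ + c) W := by
  refine ⟨((contDiff_profile_norm hα0).add contDiff_const).contDiffOn, 2, fun x _ y _ => ?_⟩
  rw [fderiv_add_const, fderiv_add_const, fderiv_profile_norm hα0, fderiv_profile_norm hα0,
    ← map_smul, ← map_smul, ← map_sub, innerSL_apply_norm]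
  exact norm_rpow_smul_sub_le hα0 hα1 x y

/-! ### A bounded example -/

/-- A smooth function with `tent t = t` for `t ≤ 1/2` and `tent t = 2 - t` for `t ≥ 3/2`. -/
def tent (t : ℝ) : ℝ :=
  t * (1 - Real.smoothTransition (t - 1 / 2)) + (2 - t) * Real.smoothTransition (t - 1 / 2)

theorem contDiff_tent {n : ℕ∞} : ContDiff ℝ n tent := by
  have h : ContDiff ℝ n fun t : ℝ => Real.smoothTransition (t - 1 / 2) :=
    Real.smoothTransition.contDiff.comp (contDiff_id.sub contDiff_const)
  unfold tent
  fun_prop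

theorem continuous_tent : Continuous tent := (contDiff_tent (n := 0)).continuous

theorem tent_of_le {t : ℝ} (h : t ≤ 1 / 2) : tent t = t := by
  rw [tent, Real.smoothTransition.zero_of_nonpos (by linarith)]
  ring

theorem tent_of_ge {t : ℝ} (h : 3 / 2 ≤ t) : tent t = 2 - t := by
  rw [tent, Real.smoothTransition.one_of_one_le (by linarith)]
  ring

theorem tent_pos_of_mem_Icc {t : ℝ} (h : t ∈ Icc (1 / 2 : ℝ) (3 / 2)) : 0 < tent t := by
  have h0 := Real.smoothTransition.nonneg (t - 1 / 2)
  have h1 := Real.smoothTransition.le_one (t - 1 / 2)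
  unfold tent
  nlinarith [h.1, h.2, mul_nonneg (sub_nonneg.2 h.1) (sub_nonneg.2 h1),
    mul_nonneg (sub_nonneg.2 h.2) h0]

theorem tent_pos_iff {t : ℝ} : 0 < tent t ↔ t ∈ Ioo (0 : ℝ) 2 := by
  rcases le_total t (1 / 2) with h | h
  · rw [tent_of_le h]
    exact ⟨fun h' => ⟨h', by linarith⟩, fun h' => h'.1⟩
  rcases le_total (3 / 2) t with h' | h'
  · rw [tent_of_ge h', sub_pos]
    exact ⟨fun h' => ⟨by linarith, h'⟩, fun h' => h'.2⟩
  · exact iff_of_true (tent_pos_of_mem_Icc ⟨h, h'⟩) ⟨by linarith, by linarith⟩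

theorem tent_eq_zero {t : ℝ} (ht : tent t = 0) : t = 0 ∨ t = 2 := by
  rcases le_total t (1 / 2) with h | h
  · exact Or.inl (by rwa [tent_of_le h] at ht)
  rcases le_total (3 / 2) t with h' | h'
  · rw [tent_of_ge h'] at ht
    exact Or.inr (by linarith)
  · exact absurd ht (tent_pos_of_mem_Icc ⟨h, h'⟩).ne'

theorem tent_le_two {t : ℝ} (ht : t ∈ Ioo (0 : ℝ) 2) : tent t ≤ 2 := by
  have h0 := Real.smoothTransition.nonneg (t - 1 / 2)
  have h1 := Real.smoothTransition.le_one (t - 1 / 2)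
  unfold tent
  nlinarith [mul_nonneg ht.1.le h0, mul_nonneg (sub_nonneg.2 ht.2.le) (sub_nonneg.2 h1)]

/-- A bounded domain of revolution whose lower part is the region above the graph of the profile. -/
def spindle (d : ℕ) (α : ℝ) : Set (Euc (d + 1)) := {x | profile α ‖horiz x‖ < tent (vert x)}

section Spindle

variable {d : ℕ} {α : ℝ}

theorem mem_spindle {x : Euc (d + 1)} :
    x ∈ spindle d α ↔ profile α ‖horiz x‖ < tent (vert x) := Iff.rfl

theorem isOpen_spindle (hα : 0 < α) : IsOpen (spindle d α) :=
  isOpen_lt ((continuous_profile hα).comp continuous_horiz.norm)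
    (continuous_tent.comp continuous_vert)

theorem vert_mem_of_mem_spindle (hα : 0 < α) {x : Euc (d + 1)} (hx : x ∈ spindle d α) :
    vert x ∈ Ioo (0 : ℝ) 2 :=
  tent_pos_iff.1 ((profile_nonneg hα _).trans_lt hx)

theorem mkPoint_zero_mem_spindle (hα : 0 < α) {t : ℝ} (ht : t ∈ Ioo (0 : ℝ) 2) :
    mkPoint 0 t ∈ spindle d α := by
  simpa [mem_spindle, profile_zero hα] using tent_pos_iff.2 ht

theorem isBounded_spindle (hα0 : 0 < α) (hα1 : α < 1) : Bornology.IsBounded (spindle d α) := by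
  refine (isBounded_closedBall (x := 0) (r := 6)).subset fun x hx => ?_
  have hv := vert_mem_of_mem_spindle hα0 hx
  have h1 : profile α ‖horiz x‖ < 2 := lt_of_lt_of_le hx (tent_le_two hv)
  have h2 : ‖horiz x‖ ≤ 4 := by
    by_contra! h
    -- If |x'| > 4, then |x'| ≤ |x'|^(1+α) < 2(1 + α) < 4, a contradiction.
    have h3 : ‖horiz x‖ ≤ ‖horiz x‖ ^ (1 + α) :=
      Real.self_le_rpow_of_one_le (by linarith) (by linarith)
    rw [profile_norm, div_lt_iff₀ (by linarith)] at h1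
    linarith
  rw [mem_closedBall_zero_iff]
  have h4 : |vert x| ≤ 2 := abs_le.2 ⟨by linarith [hv.1], hv.2.le⟩
  linarith [norm_le_horiz_add_vert x]

/-- Every point slides horizontally to the axis inside the set, and the part of the axis in the set
is an open segment. -/
theorem isConnected_spindle (hα : 0 < α) : IsConnected (spindle d α) := by
  refine ⟨⟨_, mkPoint_zero_mem_spindle hα (t := 1) (by norm_num)⟩,
    isPreconnected_of_forall (mkPoint 0 1) fun x hx => ?_⟩
  have hv := vert_mem_of_mem_spindle hα hx
  set A : Set (Euc (d + 1)) := (fun t => mkPoint 0 t) '' Ioo (0 : ℝ) 2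
  set B : Set (Euc (d + 1)) := (fun c : ℝ => mkPoint (c • horiz x) (vert x)) '' Icc 0 1
  have hA : IsPreconnected A := isPreconnected_Ioo.image _
    (continuous_const.mkPoint continuous_id).continuousOn
  have hB : IsPreconnected B := isPreconnected_Icc.image _
    ((continuous_id.smul continuous_const).mkPoint continuous_const).continuousOn
  refine ⟨A ∪ B, union_subset ?_ ?_, Or.inl ⟨1, by norm_num, rfl⟩,
    Or.inr ⟨1, by norm_num, by simp⟩,
    hA.union (mkPoint 0 (vert x)) ⟨_, hv, rfl⟩ ⟨0, by norm_num, by simp⟩ hB⟩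
  · rintro _ ⟨t, ht, rfl⟩
    exact mkPoint_zero_mem_spindle hα ht
  · rintro _ ⟨c, hc, rfl⟩
    rw [mem_spindle, horiz_mkPoint, vert_mkPoint]
    refine lt_of_le_of_lt ?_ hx
    rw [profile_le_profile hα (norm_nonneg _) (norm_nonneg _), norm_smul,
      Real.norm_of_nonneg hc.1]
    exact mul_le_of_le_one_left (norm_nonneg _) hc.2

theorem eq_of_mem_frontier_spindle (hα : 0 < α) {x : Euc (d + 1)}
    (hx : x ∈ frontier (spindle d α)) : profile α ‖horiz x‖ = tent (vert x) :=
  frontier_lt_subset_eq ((continuous_profile hα).comp continuous_horiz.norm)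
    (continuous_tent.comp continuous_vert) hx

theorem contDiffAt_spindle {p : Euc (d + 1)} (hp : horiz p ≠ 0) :
    ContDiffAt ℝ 2 (fun x => profile α ‖horiz x‖ - tent (vert x)) p := by
  refine ContDiffAt.sub ?_ ((contDiff_tent (n := 2)).comp contDiff_vert).contDiffAt
  simp only [profile_norm]
  refine ContDiffAt.div_const ?_ _
  exact (contDiff_horiz.contDiffAt.norm ℝ hp).rpow_const_of_ne (norm_ne_zero_iff.2 hp)

/-- The derivative in the radial direction (p', 0) is |p'|^(α-1)|p'|², which is nonzero off the
axis. -/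
theorem fderiv_spindle_ne_zero (hα : 0 < α) {p : Euc (d + 1)} (hp : horiz p ≠ 0) :
    fderiv ℝ (fun x => profile α ‖horiz x‖ - tent (vert x)) p ≠ 0 := by
  have hh : HasFDerivAt horiz ((ContinuousLinearMap.fst ℝ (Euc d) ℝ).comp
      (splitL d : Euc (d + 1) →L[ℝ] Euc d × ℝ)) p :=
    ((ContinuousLinearMap.fst ℝ (Euc d) ℝ).comp
      (splitL d : Euc (d + 1) →L[ℝ] Euc d × ℝ)).hasFDerivAt
  have hv : HasFDerivAt vert ((ContinuousLinearMap.snd ℝ (Euc d) ℝ).comp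
      (splitL d : Euc (d + 1) →L[ℝ] Euc d × ℝ)) p :=
    ((ContinuousLinearMap.snd ℝ (Euc d) ℝ).comp
      (splitL d : Euc (d + 1) →L[ℝ] Euc d × ℝ)).hasFDerivAt
  have h1 := (((contDiff_profile_norm (d := d) hα).differentiable one_ne_zero
    (horiz p)).hasFDerivAt).comp p hh
  have h2 := (((contDiff_tent (n := 1)).differentiable one_ne_zero
    (vert p)).hasDerivAt).comp_hasFDerivAt p hv
  intro h
  have h3 := (h1.sub h2).fderiv
  have h4 : (fun x => profile α ‖horiz x‖ - tent (vert x)) =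
      ((fun z : Euc d => profile α ‖z‖) ∘ horiz - tent ∘ vert) := rfl
  rw [← h4, h] at h3
  have h5 := DFunLike.congr_fun h3 (mkPoint (horiz p) 0)
  simp [fderiv_profile_norm hα] at h5
  exact h5.elim (Real.rpow_pos_of_pos (norm_pos_iff.2 hp) _).ne' hp

/-- The boundary meets the axis only at the heights 0 and 2, where it is exactly a profile graph,
reflected at the upper end. Off the axis the defining function is C^2 with nonzero derivative, and
the implicit function theorem applies. -/
theorem isC1HolderDomain_spindle (hα0 : 0 < α) (hα1 : α < 1) :
    IsC1HolderDomain α (spindle d α) := by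
  refine ⟨isOpen_spindle hα0, isConnected_spindle hα0, fun p hp => ?_⟩
  have hpe := eq_of_mem_frontier_spindle hα0 hp
  by_cases hh : horiz p = 0
  · rw [hh, norm_zero, profile_zero hα0] at hpe
    have hvp : ∀ x ∈ ball p (1 / 2), |vert x - vert p| < 1 / 2 := fun x hx => by
      rw [mem_ball, dist_eq_norm] at hx
      exact (abs_vert_le (x - p)).trans_lt hx
    refine ⟨1 / 2, by norm_num, ?_⟩
    rcases tent_eq_zero hpe.symm with h | h
    · refine ⟨LinearIsometryEquiv.refl ℝ _, _, isC1HolderOn_profile_norm hα0 hα1 0 _,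
        fun x hx => ?_⟩
      have := (abs_lt.1 (hvp x hx)).2
      rw [mem_spindle, tent_of_le (by linarith)]
      simp
    -- Under x ↦ -x the condition ψ(|x'|) < 2 - x_N reads ψ - 2 < -x_N, whence the constant -2.
    · refine ⟨LinearIsometryEquiv.neg ℝ, _, isC1HolderOn_profile_norm hα0 hα1 (-2) _,
        fun x hx => ?_⟩
      have := (abs_lt.1 (hvp x hx)).1
      rw [mem_spindle, tent_of_ge (by linarith)]
      simp only [LinearIsometryEquiv.coe_neg, horiz_neg, vert_neg, norm_neg]
      constructor <;> intro h <;> linarith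
  · obtain ⟨ρ, hρ, T, f, hf, hx⟩ := exists_graph_of_contDiffAt hα1
      (contDiffAt_spindle (α := α) hh) (sub_eq_zero.2 hpe) (fderiv_spindle_ne_zero hα0 hh)
    exact ⟨ρ, hρ, T, f, hf, fun x hxb => by rw [mem_spindle, ← sub_neg, hx x hxb]⟩

theorem isPowerDomain_spindle (hα0 : 0 < α) (hα1 : α < 1) :
    IsPowerDomain α (1 / 2) (spindle d α) := by
  have hbelow : spindle d α ∩ {x | vert x < 1 / 2} =
      {x | profile α ‖horiz x‖ < vert x ∧ vert x < 1 / 2} := by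
    ext x
    refine and_congr_left fun h => ?_
    rw [mem_spindle, tent_of_le (le_of_lt h)]
  refine ⟨isC1HolderDomain_spindle hα0 hα1, ?_, hbelow⟩
  rw [(isOpen_spindle hα0).frontier_eq]
  refine ⟨?_, fun h => ?_⟩
  · have hlim : Tendsto (fun t : ℝ => (mkPoint 0 t : Euc (d + 1))) (𝓝[>] 0) (𝓝 0) := by
      rw [← mkPoint_zero_zero]
      exact (continuous_const.mkPoint continuous_id).continuousAt.tendsto.mono_left
        nhdsWithin_le_nhds
    refine mem_closure_of_tendsto hlim ?_
    filter_upwards [Ioo_mem_nhdsGT (show (0 : ℝ) < 2 by norm_num)] with t ht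
    exact mkPoint_zero_mem_spindle hα0 ht
  · simpa using (vert_mem_of_mem_spindle hα0 h).1

end Spindle

/-! ### Comparison of orders and failure of the inequality -/

theorem tendsto_profile_nhdsGT {α : ℝ} (hα : 0 < α) {r : ℕ → ℝ}
    (hr : Tendsto r atTop (𝓝[>] 0)) : Tendsto (fun n => profile α (r n)) atTop (𝓝 0) := by
  have h := (continuous_profile hα).tendsto 0
  rw [profile_zero hα] at h
  exact h.comp (hr.mono_right nhdsWithin_le_nhds)

/-- A function of the shape `A s^(d+2α) - K s^(d+4α) - C s^(d+1+α)` with `A > 0` is positive for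
small `s > 0`. -/
theorem eventually_lt_of_expansion {A K C α D : ℝ} (hA : 0 < A) (hα0 : 0 < α) (hα1 : α < 1) :
    -- Division by s^(D+2α) leaves the exponents 1 - α and 2α, both positive; this is where the
    -- regularity below C^{1,1} enters.
    ∀ᶠ s in 𝓝[>] (0 : ℝ),
      C * s ^ (D + 1 + α) + K * s ^ (D + 4 * α) < A * s ^ (D + 2 * α) := by
  have h1 : Tendsto (fun s : ℝ => C * s ^ (1 - α) + K * s ^ (2 * α)) (𝓝[>] 0) (𝓝 0) := by
    have hc : Continuous fun s : ℝ => C * s ^ (1 - α) + K * s ^ (2 * α) :=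
      ((Real.continuous_rpow_const (by linarith)).const_mul C).add
        ((Real.continuous_rpow_const (by linarith)).const_mul K)
    have := hc.tendsto 0
    rw [Real.zero_rpow (by linarith), Real.zero_rpow (by linarith)] at this
    simp only [mul_zero, add_zero] at this
    exact this.mono_left nhdsWithin_le_nhds
  filter_upwards [h1.eventually (gt_mem_nhds hA), self_mem_nhdsWithin] with s hs hs0
  have hs0 : 0 < s := hs0
  have h2 : s ^ (D + 1 + α) = s ^ (1 - α) * s ^ (D + 2 * α) := by
    rw [← Real.rpow_add hs0]
    ring_nf
  have h3 : s ^ (D + 4 * α) = s ^ (2 * α) * s ^ (D + 2 * α) := by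
    rw [← Real.rpow_add hs0]
    ring_nf
  rw [h2, h3]
  have := mul_lt_mul_of_pos_right hs (Real.rpow_pos_of_pos hs0 (D + 2 * α))
  linarith

section

variable {d : ℕ} {α η : ℝ} {Ω : Set (Euc (d + 1))}

theorem IsPowerDomain.toReal_totalVariation_testFun (hd : 1 ≤ d) (hΩ : IsPowerDomain α η Ω)
    (hα : 0 < α) {r : ℝ} (hr0 : 0 < r) (hr : profile α r < η) :
    (totalVariation Ω (testFun d α r)).toReal = unitBallVolume d * r ^ d := by
  rw [hΩ.totalVariation_testFun hd hα hr0 hr,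
    ENNReal.toReal_ofReal (mul_nonneg (unitBallVolume_pos d).le (by positivity))]

/-- The test functions violate the trace inequality for any constant. -/
theorem IsPowerDomain.eventually_violates (hd : 1 ≤ d) (hα0 : 0 < α) (hα1 : α < 1) (hη : 0 < η)
    (hΩ : IsPowerDomain α η Ω) {r : ℕ → ℝ} (hr : Tendsto r atTop (𝓝[>] 0)) (C : ℝ) :
    ∀ᶠ n in atTop,
      (totalVariation Ω (testFun d α (r n))).toReal + C * ∫ x in Ω, |testFun d α (r n) x| <
        boundaryIntegral Ω (testFun d α (r n)) := by
  have hA : 0 < (d : ℝ) * unitBallVolume d / (2 * ((d : ℝ) + 2 * α)) := by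
    have := unitBallVolume_pos d
    have hd' : (0 : ℝ) < d := by exact_mod_cast hd
    positivity
  filter_upwards [(tendsto_profile_nhdsGT hα0 hr).eventually (gt_mem_nhds hη),
    hr.eventually self_mem_nhdsWithin,
    hr.eventually (eventually_lt_of_expansion (D := d) (C := C * (unitBallVolume d / ((d : ℝ) + 1 + α)))
      (K := (d : ℝ) * unitBallVolume d / ((d : ℝ) + 4 * α) / 8) hA hα0 hα1)] with n hn hn0 hlt
  have hn0 : 0 < r n := hn0
  rw [hΩ.toReal_totalVariation_testFun hd hα0 hn0 hn, hΩ.integral_abs_testFun hd hα0 hn0 hn,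
    hΩ.boundaryIntegral_testFun hα0 hn0 hn]
  have := (abs_le.1 (abs_graph_area_sub_le hd hα0 hn0.le)).1
  linarith

end

end

theorem mainTheorem2 (d : ℕ) (hd : 1 ≤ d) (α : ℝ) (hα0 : 0 < α) (hα1 : α < 1) :
    -- domains of the kind considered exist, even bounded ones
    (∃ (Ω : Set (Euc (d + 1))) (η : ℝ), 0 < η ∧ Bornology.IsBounded Ω ∧ IsPowerDomain α η Ω) ∧
    ∀ (Ω : Set (Euc (d + 1))) (η : ℝ), 0 < η → IsPowerDomain α η Ω →
      (∀ r : ℕ → ℝ, Tendsto r atTop (𝓝[>] 0) →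
        -- the test functions: membership, trace and the exact values of the three integrals
        (∀ᶠ n in atTop,
          testRegion d α (r n) ⊆ Ω ∧
          MemBV Ω (testFun d α (r n)) ∧
          (∀ᵐ x ∂((Measure.euclideanHausdorffMeasure d).restrict (frontier Ω)),
            HasTraceAt Ω (testFun d α (r n)) x
              ({y : Euc (d + 1) | vert y < profile α (r n)}.indicator (fun _ => (1 : ℝ)) x)) ∧
          boundaryIntegral Ω (testFun d α (r n)) =
            ∫ z in ball (0 : Euc d) (r n), Real.sqrt (1 + ‖z‖ ^ (2 * α)) ∧
          (totalVariation Ω (testFun d α (r n))).toReal = unitBallVolume d * r n ^ d ∧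
          ∫ x in Ω, |testFun d α (r n) x| =
            unitBallVolume d / ((d : ℝ) + 1 + α) * r n ^ ((d : ℝ) + 1 + α)) ∧
        -- the asymptotic expansion of the boundary integral
        ((fun n => boundaryIntegral Ω (testFun d α (r n)) -
            (unitBallVolume d * r n ^ d +
              (d : ℝ) * unitBallVolume d / (2 * ((d : ℝ) + 2 * α)) * r n ^ ((d : ℝ) + 2 * α)))
          =O[atTop] fun n => r n ^ ((d : ℝ) + 4 * α)) ∧
        -- the test functions eventually violate the inequality, whatever the constant
        (∀ C : ℝ, ∀ᶠ n in atTop,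
          (totalVariation Ω (testFun d α (r n))).toReal + C * ∫ x in Ω, |testFun d α (r n) x| <
            boundaryIntegral Ω (testFun d α (r n)))) ∧
      -- hence the inequality holds on `BV(Ω)` for no constant
      ¬ ∃ C : ℝ, TraceInequality Ω C := by
  refine ⟨⟨spindle d α, 1 / 2, by norm_num, isBounded_spindle hα0 hα1,
    isPowerDomain_spindle hα0 hα1⟩, fun Ω η hη hΩ => ⟨fun r hr => ?_, ?_⟩⟩
  · have hsmall : ∀ᶠ n in atTop, 0 < r n ∧ profile α (r n) < η :=
      (hr.eventually self_mem_nhdsWithin).and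
        ((tendsto_profile_nhdsGT hα0 hr).eventually (gt_mem_nhds hη))
    refine ⟨?_, ?_, hΩ.eventually_violates hd hα0 hα1 hη hr⟩
    · filter_upwards [hsmall] with n hn
      exact ⟨hΩ.testRegion_subset hn.2, hΩ.memBV_testFun hd hα0 hn.1 hn.2,
        hΩ.ae_hasTraceAt hα0 hn.1 hn.2, hΩ.boundaryIntegral_testFun hα0 hn.1 hn.2,
        hΩ.toReal_totalVariation_testFun hd hα0 hn.1 hn.2,
        hΩ.integral_abs_testFun hd hα0 hn.1 hn.2⟩
    · refine IsBigO.of_bound ((d : ℝ) * unitBallVolume d / ((d : ℝ) + 4 * α) / 8) ?_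
      filter_upwards [hsmall] with n hn
      rw [hΩ.boundaryIntegral_testFun hα0 hn.1 hn.2, Real.norm_eq_abs,
        Real.norm_of_nonneg (Real.rpow_nonneg hn.1.le _)]
      exact abs_graph_area_sub_le hd hα0 hn.1.le
  · rintro ⟨C, hC⟩
    -- Any sequence of positive radii tending to 0 refutes a given C; one violating member suffices.
    have hr : Tendsto (fun n : ℕ => 1 / ((n : ℝ) + 1)) atTop (𝓝[>] 0) :=
      tendsto_nhdsWithin_iff.2 ⟨tendsto_one_div_add_atTop_nhds_zero_nat,
        Eventually.of_forall fun n => by simp only [mem_Ioi]; positivity⟩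
    have hev := (hΩ.eventually_violates hd hα0 hα1 hη hr C).and
      ((hr.eventually self_mem_nhdsWithin).and
        ((tendsto_profile_nhdsGT hα0 hr).eventually (gt_mem_nhds hη)))
    obtain ⟨n, hlt, hn0, hn⟩ := hev.exists
    exact (hC _ (hΩ.memBV_testFun hd hα0 hn0 hn)).not_gt hlt
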